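/- Let $\alpha$ be an infinite ordinal (or any infinite index set). A cylindric algebra of dimension $\alpha$ (a $\mathsf{CA}_\alpha$) is an algebra $\mathfrak A=\langle A,+,-,c_i,d_{ij}\rangle_{i,j\in\alpha}$ such that $\langle A,+,-\rangle$ is a Boolean algebra and, for all $x,y\in A$ and all distinct $i,j,k\in\alpha$: $c_ic_jx=c_jc_ix$, $x\le c_ix=c_ic_ix$, $c_i(x+y)=c_ix+c_iy$, $c_i(-c_ix)=-c_ix$, $d_{ii}=1$, $d_{ij}=d_{ji}$, $c_j(d_{ij}\cdot d_{jk})=d_{ik}$, $c_id_{ij}=1$, $d_{ij}\cdot c_i(d_{ij}\cdot x)=d_{ij}\cdot x$. For a set $V$ of $\alpha$-sequences over a set $U$, the full cylindric set algebra with unit $V$ is the algebra of all subsets of $V$ with union, complement relative to $V$, $C_iX=\{s\in V: s \text{ differs from some } t\in X \text{ at most at } i\}$ and $D_{ij}=\{s\in V: s_i=s_j\}$. Let $\mathsf{RCA}_\alpha$ (the representable algebras) be the class of all algebras isomorphic to a subalgebra of a full cylindric set algebra whose unit is a disjoint union of sets of the form ${}^\alpha W$. A $\mathsf{CA}_\alpha$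 $\mathfrak A$ is endo-dimension-complemented (endo-dc) if for every finite $\Gamma\subseteq\alpha$ and every nonzero $x\in A$ there are $\kappa\in\alpha\setminus\Gamma$ and an endomorphism $h$ of the reduct $\langle A,+,-,c_i,d_{ij}\rangle_{i,j\in\Gamma}$ such that $h(x)\neq 0$ and $c_\kappa h(a)=h(a)$ for all $a\in A$. Let $\mathsf{Edc}_\alpha$ be the class of endo-dc $\mathsf{CA}_\alpha$'s, and for a class $\mathsf K$ let $\mathbf S\,\mathsf K$ be the class of all algebras isomorphic to subalgebras of members of $\mathsf K$. Theorem. There is an algebra in $\mathsf{RCA}_\alpha$ that is not endo-dc, but every algebra in $\mathsf{RCA}_\alpha$ can be embedded into an endo-dc algebra. In symbols, $\mathsf{Edc}_\alpha\subsetneq\mathbf S\,\mathsf{Edc}_\alpha=\mathsf{RCA}_\alpha$. -/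

import Mathlib

universe u v w

/-- Algebras of the similarity type of cylindric algebras of dimension `ι` with a Boolean reduct:
a Boolean algebra with unary operations `c i` (cylindrifications) and constants `d i j`
(diagonals). -/
class CylStr (ι : Type u) (A : Type w) extends BooleanAlgebra A where
  c : ι → A → A
  d : ι → ι → A

/-- A bundled Boolean algebra with operations `c i` and constants `d i j`, `i, j : ι`. -/
structure CylAlg (ι : Type u) : Type (max u (w + 1)) where
  carrier : Type w
  [str : CylStr ι carrier]

namespace CylAlg

instance (ι : Type u) : CoeSort (CylAlg.{u, w} ι) (Type w) := ⟨CylAlg.carrier⟩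

instance (ι : Type u) (A : CylAlg.{u, w} ι) : CylStr ι A := A.str

/-- The cylindrification `c_i` of `A`. -/
abbrev c {ι : Type u} (A : CylAlg.{u, w} ι) (i : ι) (x : A) : A := CylStr.c i x

/-- The diagonal constant `d_{ij}` of `A`. -/
abbrev d {ι : Type u} (A : CylAlg.{u, w} ι) (i j : ι) : A := CylStr.d i j

/-- Homomorphisms: maps that preserve `+`, `-`, all `c_i` and all `d_{ij}` (hence also the other
Boolean operations). -/
structure Hom {ι : Type u} (A : CylAlg.{u, v} ι) (B : CylAlg.{u, w} ι) where
  toFun : A → B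
  map_sup : ∀ x y : A, toFun (x ⊔ y) = toFun x ⊔ toFun y
  map_compl : ∀ x : A, toFun xᶜ = (toFun x)ᶜ
  map_c : ∀ (i : ι) (x : A), toFun (A.c i x) = B.c i (toFun x)
  map_d : ∀ i j : ι, toFun (A.d i j) = B.d i j

/-- `A` embeds into `B`, that is, `A` is isomorphic to a subalgebra of `B`. -/
def Embeds {ι : Type u} (A : CylAlg.{u, v} ι) (B : CylAlg.{u, w} ι) : Prop :=
  ∃ f : Hom A B, Function.Injective f.toFun

/-- The `Γ`-reduct of `A`: only the operations `c i`, `d i j` with `i, j ∈ Γ` are kept. -/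
abbrev reduct {ι : Type u} (A : CylAlg.{u, w} ι) (Γ : Set ι) : CylAlg.{u, w} Γ where
  carrier := A.carrier
  str :=
    { (inferInstance : BooleanAlgebra A.carrier) with
      c := fun i x => A.c i x
      d := fun i j => A.d i j }

end CylAlg

/-- The class `CA_ι` of cylindric algebras of dimension `ι`. -/
structure IsCylindric {ι : Type u} (A : CylAlg.{u, w} ι) : Prop where
  c_comm : ∀ (i j : ι) (x : A), A.c i (A.c j x) = A.c j (A.c i x)
  le_c : ∀ (i : ι) (x : A), x ≤ A.c i x
  c_c : ∀ (i : ι) (x : A), A.c i (A.c i x) = A.c i x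
  c_sup : ∀ (i : ι) (x y : A), A.c i (x ⊔ y) = A.c i x ⊔ A.c i y
  c_compl_c : ∀ (i : ι) (x : A), A.c i (A.c i x)ᶜ = (A.c i x)ᶜ
  d_self : ∀ i : ι, A.d i i = ⊤
  d_symm : ∀ i j : ι, A.d i j = A.d j i
  c_d_inf_d : ∀ i j k : ι, i ≠ j → j ≠ k → i ≠ k → A.c j (A.d i j ⊓ A.d j k) = A.d i k
  c_d : ∀ i j : ι, i ≠ j → A.c i (A.d i j) = ⊤
  d_inf_c : ∀ (i j : ι) (x : A), i ≠ j → A.d i j ⊓ A.c i (A.d i j ⊓ x) = A.d i j ⊓ x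

/-- The full cylindric set algebra with unit `V`, where `V` is a set of `ι`-sequences over `U`.
Its elements are the subsets of `V`; `C_i X` consists of the sequences in `V` that agree with some
member of `X` at all places other than `i`, and `D_{ij} = {s ∈ V | s_i = s_j}`. -/
abbrev fullSetAlg {ι : Type u} {U : Type w} (V : Set (ι → U)) : CylAlg.{u, max u w} ι where
  carrier := Set V
  str :=
    { (inferInstance : BooleanAlgebra (Set V)) with
      c := fun i X => {s : V | ∃ t : V, t ∈ X ∧ ∀ j : ι, j ≠ i → s.1 j = t.1 j}
      d := fun i j => {s : V | s.1 i = s.1 j} }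

/-- The `ι`-dimensional space over the base `W`: all `ι`-sequences with values in `W`. -/
def space (ι : Type u) {U : Type w} (W : Set U) : Set (ι → U) := {s | ∀ i, s i ∈ W}

/-- `V` is the union of a family of pairwise disjoint `ι`-dimensional spaces. -/
def IsDisjointUnionOfSpaces {ι : Type u} {U : Type w} (V : Set (ι → U)) : Prop :=
  ∃ S : Set (Set U), S.PairwiseDisjoint (fun W => space ι W) ∧ V = ⋃ W ∈ S, space ι W

/-- The class `RCA_ι` of representable algebras (for `ι` with more than one element): algebras
isomorphic to subalgebras of full cylindric set algebras whose unit is a disjoint union of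
`ι`-dimensional spaces. -/
def RCA (ι : Type u) : Set (CylAlg.{u, w} ι) :=
  {A | ∃ (U : Type (max u w)) (V : Set (ι → U)),
    IsDisjointUnionOfSpaces V ∧ A.Embeds (fullSetAlg V)}

/-- The class `Edc_ι` of endo-dimension-complemented cylindric algebras of dimension `ι`. -/
def Edc (ι : Type u) : Set (CylAlg.{u, w} ι) :=
  {A | IsCylindric A ∧
    ∀ Γ : Set ι, Γ.Finite → ∀ x : A, x ≠ ⊥ →
      ∃ κ : ι, κ ∉ Γ ∧ ∃ h : CylAlg.Hom (A.reduct Γ) (A.reduct Γ),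
        h.toFun x ≠ (⊥ : A) ∧ ∀ a : A, A.c κ (h.toFun a) = h.toFun a}

/-- `S K`: the class of (isomorphic copies of) subalgebras of members of `K`. -/
def SubClass {ι : Type u} (K : Set (CylAlg.{u, w} ι)) : Set (CylAlg.{u, w} ι) :=
  {A | ∃ B ∈ K, A.Embeds B}

/-!
The proof has three parts.

*Representable algebras embed into endo-dc ones.* If the unit `V` is a disjoint union of spaces,
the full set algebra on `V` is itself endo-dc (`fullSetAlg_mem_Edc`): choose an injective
`τ : ι → ι` that fixes the finite set `Γ` pointwise and misses some `κ`, and map `X` to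
`{s | s ∘ τ ∈ X}`. Injectivity makes this commute with `c_i` for `i ∈ Γ` and keeps nonempty sets
nonempty, and the image does not depend on the coordinate `κ`.

*Not every representable algebra is endo-dc.* Colour the sequences over a large base so that, by
changing one entry, any colour can be reached (`exists_isGeneric`). The sets of sequences that
depend only on the kernel of a sequence and, for injective sequences, on its colour form a
subalgebra of the full set algebra. An endomorphism of the `{i}`-reduct that does not kill a colour
class sends the colour classes to disjoint sets with the same `i`-cylindrification. If these images
are `κ`-closed, they cannot see colours, since injectivity can be destroyed at `κ`; so they can only
be told apart by which entry is repeated at `i`, and there are fewer coordinates than colours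
(`IsGeneric.not_mem_Edc`).

*Endo-dc algebras are representable.* Iterating the definition, for every finite `Γ` one can free
any finite number of coordinates outside `Γ` by a single endomorphism `h` of the `Γ`-reduct
(`exists_reductEndo_of_mem_Edc`). The freed coordinates serve as names for finitely many Henkin
witnesses: a formula "`v` satisfies `a`" is interpreted by substituting the names `v` into `h a`, and
since a fresh name is unconstrained, some ultrafilter of the algebra makes all these witnesses do
their job (`exists_ne_bot_le_witness`). A limit over all finite sets of Henkin terms yields a
representation of the `Γ`-reduct (`exists_isHenkin_univ`, `IsHenkin.exists_reductRep`), an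
ultraproduct over all `Γ` one of the whole algebra (`exists_rep_of_finite_reductRep`), and the
disjoint union over all nonzero elements a faithful one (`mem_RCA_of_reductRep`).
-/

/-! ### Set algebras on disjoint unions of spaces -/

/-- Disjointness makes the space through a point unique, so a coordinate of `s` may be replaced by
any entry of a sequence that meets `s`. -/
theorem IsDisjointUnionOfSpaces.update_mem {ι : Type u} {U : Type w} [DecidableEq ι]
    {V : Set (ι → U)} (hV : IsDisjointUnionOfSpaces V) {s r : ι → U} (hs : s ∈ V) (hr : r ∈ V)
    {k l : ι} (hkl : s k = r l) (j m : ι) : Function.update s j (r m) ∈ V := by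
  obtain ⟨S, hS, rfl⟩ := hV
  simp only [Set.mem_iUnion, exists_prop] at hs hr ⊢
  obtain ⟨W, hW, hsW⟩ := hs
  obtain ⟨W', hW', hrW⟩ := hr
  have hWW : W = W' := by
    by_contra hne
    have hd : Disjoint (space ι W) (space ι W') := hS hW hW' hne
    have hmem : (fun _ => s k) ∈ space ι W ∩ space ι W' := ⟨fun _ => hsW k, fun _ => hkl ▸ hrW l⟩
    exact hd.le_bot hmem
  subst hWW
  refine ⟨W, hW, fun i => ?_⟩
  by_cases hij : i = j
  · subst hij
    simpa using hrW m
  · simpa [hij] using hsW i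

theorem IsDisjointUnionOfSpaces.comp_mem {ι : Type u} {U : Type w} {V : Set (ι → U)}
    (hV : IsDisjointUnionOfSpaces V) {s : ι → U} (hs : s ∈ V) (τ : ι → ι) : s ∘ τ ∈ V := by
  obtain ⟨S, hS, rfl⟩ := hV
  simp only [Set.mem_iUnion, exists_prop] at hs ⊢
  obtain ⟨W, hW, hsW⟩ := hs
  exact ⟨W, hW, fun i => hsW (τ i)⟩

theorem isCylindric_fullSetAlg {ι : Type u} [Infinite ι] {U : Type w} {V : Set (ι → U)}
    (hV : IsDisjointUnionOfSpaces V) : IsCylindric (fullSetAlg V) := by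
  classical
  have hcomm : ∀ (i j : ι) (x : Set V),
      (fullSetAlg V).c i ((fullSetAlg V).c j x) ⊆ (fullSetAlg V).c j ((fullSetAlg V).c i x) := by
    rintro i j x s ⟨t, ⟨r, hr, hrt⟩, hts⟩
    by_cases hij : i = j
    · subst hij
      exact ⟨t, ⟨r, hr, hrt⟩, hts⟩
    obtain ⟨k, hk⟩ := Infinite.exists_notMem_finset {i, j}
    simp only [Finset.mem_insert, Finset.mem_singleton, not_or] at hk
    have hsr : s.1 k = r.1 k := (hts k hk.1).trans (hrt k hk.2)
    refine ⟨⟨_, hV.update_mem s.2 r.2 hsr j j⟩, ⟨r, hr, fun l hl => ?_⟩, fun l hl => ?_⟩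
    · by_cases hlj : l = j
      · subst hlj
        simp
      · simpa [hlj] using (hts l hl).trans (hrt l hlj)
    · simp [hl]
  constructor
  · exact fun i j x => Set.Subset.antisymm (hcomm i j x) (hcomm j i x)
  · exact fun i x s hs => ⟨s, hs, fun _ _ => rfl⟩
  · refine fun i x => Set.Subset.antisymm ?_ fun s hs => ⟨s, hs, fun _ _ => rfl⟩
    rintro s ⟨t, ⟨r, hr, hrt⟩, hts⟩
    exact ⟨r, hr, fun j hj => (hts j hj).trans (hrt j hj)⟩
  · intro i x y
    ext s
    constructor
    · rintro ⟨t, ht | ht, hts⟩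
      exacts [Or.inl ⟨t, ht, hts⟩, Or.inr ⟨t, ht, hts⟩]
    · rintro (⟨t, ht, hts⟩ | ⟨t, ht, hts⟩)
      exacts [⟨t, Or.inl ht, hts⟩, ⟨t, Or.inr ht, hts⟩]
  · intro i x
    refine Set.Subset.antisymm ?_ fun s hs => ⟨s, hs, fun _ _ => rfl⟩
    rintro s ⟨t, ht, hts⟩ ⟨r, hr, hrs⟩
    exact ht ⟨r, hr, fun j hj => (hts j hj).symm.trans (hrs j hj)⟩
  · intro i
    ext s
    exact ⟨fun _ => trivial, fun _ => rfl⟩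
  · intro i j
    ext s
    exact ⟨fun h => Eq.symm h, fun h => Eq.symm h⟩
  · intro i j k hij hjk hik
    ext s
    constructor
    · rintro ⟨t, ⟨ht1, ht2⟩, hts⟩
      change s.1 i = s.1 k
      rw [hts i hij, hts k hjk.symm]
      exact Eq.trans ht1 ht2
    · intro hs
      refine ⟨⟨_, hV.update_mem s.2 s.2 (rfl : s.1 i = s.1 i) j i⟩, ⟨?_, ?_⟩, fun l hl => ?_⟩
      · change Function.update s.1 j (s.1 i) i = Function.update s.1 j (s.1 i) j
        simp [hij]
      · change Function.update s.1 j (s.1 i) j = Function.update s.1 j (s.1 i) k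
        rw [Function.update_self, Function.update_of_ne hjk.symm]
        exact hs
      · simp [hl]
  · intro i j hij
    ext s
    refine ⟨fun _ => trivial, fun _ => ?_⟩
    refine ⟨⟨_, hV.update_mem s.2 s.2 (rfl : s.1 i = s.1 i) i j⟩, ?_, fun l hl => ?_⟩
    · change Function.update s.1 i (s.1 j) i = Function.update s.1 i (s.1 j) j
      simp [hij.symm]
    · simp [hl]
  · intro i j x hij
    ext s
    constructor
    · rintro ⟨hs, t, ⟨ht, htx⟩, hts⟩
      have : s = t := by
        ext l
        by_cases hl : l = i
        · subst hl
          exact (Eq.trans hs (hts j hij.symm)).trans (Eq.symm ht)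
        · exact hts l hl
      subst this
      exact ⟨hs, htx⟩
    · rintro ⟨hs, hsx⟩
      exact ⟨hs, s, ⟨hs, hsx⟩, fun _ _ => rfl⟩

/-- In an infinite type, one can make room outside a finite set `Γ` without moving `Γ`. -/
theorem exists_injective_fixing_missing {ι : Type u} [Infinite ι] {Γ : Set ι} (hΓ : Γ.Finite) :
    ∃ (κ : ι) (τ : ι → ι), κ ∉ Γ ∧ Function.Injective τ ∧ (∀ i ∈ Γ, τ i = i) ∧ ∀ i, τ i ≠ κ := by
  classical
  obtain ⟨e⟩ : Nonempty (ℕ ↪ (Γᶜ : Set ι)) := by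
    have : Infinite (Γᶜ : Set ι) := hΓ.infinite_compl.to_subtype
    exact ⟨Infinite.natEmbedding _⟩
  -- `τ` shifts the sequence `e` by one step and is the identity elsewhere.
  let f : ℕ → ι := fun n => (e n).1
  have hf : Function.Injective f := Subtype.val_injective.comp e.injective
  let τ : ι → ι := Function.extend f (fun n => f (n + 1)) id
  have h1 : ∀ n, τ (f n) = f (n + 1) := fun n => hf.extend_apply _ _ n
  have h2 : ∀ i, (¬ ∃ n, f n = i) → τ i = i := fun i hi => Function.extend_apply' _ _ i hi
  refine ⟨f 0, τ, (e 0).2, ?_, ?_, ?_⟩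
  · intro i j hij
    by_cases hi : ∃ n, f n = i <;> by_cases hj : ∃ n, f n = j
    · obtain ⟨n, rfl⟩ := hi
      obtain ⟨m, rfl⟩ := hj
      rw [h1, h1] at hij
      rw [Nat.succ_injective (hf hij)]
    · obtain ⟨n, rfl⟩ := hi
      rw [h1, h2 j hj] at hij
      exact absurd ⟨_, hij⟩ hj
    · obtain ⟨m, rfl⟩ := hj
      rw [h1, h2 i hi] at hij
      exact absurd ⟨_, hij.symm⟩ hi
    · rwa [h2 i hi, h2 j hj] at hij
  · intro i hi
    apply h2
    rintro ⟨n, rfl⟩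
    exact (e n).2 hi
  · intro i
    by_cases hi : ∃ n, f n = i
    · obtain ⟨n, rfl⟩ := hi
      rw [h1]
      exact fun h => Nat.succ_ne_zero n (hf h)
    · rw [h2 i hi]
      exact fun h => hi ⟨0, h.symm⟩

/-- The endomorphism is `X ↦ {s | s ∘ τ ∈ X}` for an injective reindexing `τ` that fixes `Γ`
pointwise and avoids `κ`. -/
theorem fullSetAlg_mem_Edc {ι : Type u} [Infinite ι] {U : Type (max u w)} {V : Set (ι → U)}
    (hV : IsDisjointUnionOfSpaces V) :
    (fullSetAlg V : CylAlg.{u, max u w} ι) ∈ Edc.{u, max u w} ι := by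
  classical
  refine ⟨isCylindric_fullSetAlg hV, fun Γ hΓ x hx => ?_⟩
  obtain ⟨κ, τ, hκ, hτ, hfix, hmiss⟩ := exists_injective_fixing_missing hΓ
  refine ⟨κ, hκ, ⟨fun X => {s : V | (⟨s.1 ∘ τ, hV.comp_mem s.2 τ⟩ : V) ∈ (X : Set V)},
    fun _ _ => rfl, fun _ => rfl, ?_, ?_⟩, ?_, ?_⟩
  · rintro ⟨i, hi⟩ X
    ext s
    constructor
    · rintro ⟨t, ht, hts⟩
      obtain ⟨k, hk⟩ := exists_ne i
      have hsk : s.1 (τ k) = t.1 k := hts k hk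
      refine ⟨⟨_, hV.update_mem s.2 t.2 hsk i i⟩, ?_, fun l hl => ?_⟩
      · change (⟨_, _⟩ : V) ∈ (X : Set V)
        convert ht using 1
        ext l
        by_cases hl : l = i
        · subst hl
          simp [hfix l hi]
        · have : τ l ≠ i := fun h => hl (hτ (h.trans (hfix i hi).symm))
          simpa [this] using hts l hl
      · have : l ≠ i := hl
        simp [this]
    · rintro ⟨t, ht, hts⟩
      refine ⟨_, ht, fun l hl => ?_⟩
      exact hts (τ l) fun h => hl (hτ (h.trans (hfix i hi).symm))
  · rintro ⟨i, hi⟩ ⟨j, hj⟩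
    ext s
    change s.1 (τ i) = s.1 (τ j) ↔ s.1 i = s.1 j
    rw [hfix i hi, hfix j hj]
  · obtain ⟨t, ht⟩ := Set.nonempty_iff_ne_empty.2 hx
    -- `t` read through an inverse of `τ` is a member of the image of `x`.
    have hinv : ∀ i, Function.invFun τ (τ i) = i := Function.leftInverse_invFun hτ
    refine Set.nonempty_iff_ne_empty.1 ⟨⟨_, hV.comp_mem t.2 (Function.invFun τ)⟩, ?_⟩
    change (⟨_, _⟩ : V) ∈ (x : Set V)
    convert ht using 1
    ext l
    simp [hinv]
  · intro X
    ext s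
    constructor
    · rintro ⟨t, ht, hts⟩
      have hst : (⟨s.1 ∘ τ, hV.comp_mem s.2 τ⟩ : V) = ⟨t.1 ∘ τ, hV.comp_mem t.2 τ⟩ :=
        Subtype.ext (funext fun l => hts (τ l) (hmiss l))
      change (⟨s.1 ∘ τ, hV.comp_mem s.2 τ⟩ : V) ∈ (X : Set V)
      rw [hst]
      exact ht
    · exact fun hs => ⟨s, hs, fun _ _ => rfl⟩

/-! ### A representable algebra that is not endo-dimension-complemented -/

section ColouredSequences

variable {ι : Type u} {U : Type w} {N : Type u}

/-- Two sequences are similar if they have the same kernel and, in case they are injective, the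
same colour. -/
def colourSetoid (f : (ι → U) → N) : Setoid (ι → U) where
  r s t := (∀ i j, s i = s j ↔ t i = t j) ∧ (Function.Injective s → f s = f t)
  iseqv :=
    { refl := fun _ => ⟨fun _ _ => Iff.rfl, fun _ => rfl⟩
      symm := fun h => ⟨fun i j => (h.1 i j).symm, fun ht =>
        (h.2 fun i j hij => ht ((h.1 i j).1 hij)).symm⟩
      trans := fun h h' => ⟨fun i j => (h.1 i j).trans (h'.1 i j), fun hs =>
        (h.2 hs).trans (h'.2 fun i j hij => hs ((h.1 i j).2 hij))⟩ }

/-- Genericity of a colouring: by changing one entry, every sequence can be given every colour, and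
the new entry can be chosen different from all the old ones. -/
def IsGeneric [DecidableEq ι] (f : (ι → U) → N) : Prop :=
  ∀ (t : ι → U) (i : ι) (n : N), ∃ u : U, (∀ j, t j ≠ u) ∧ f (Function.update t i u) = n

/-- The algebra of all sets of sequences that are invariant under similarity, encoded as the
algebra of all sets of similarity classes. -/
abbrev colourAlg (f : (ι → U) → N) : CylAlg.{u, max u w} ι where
  carrier := Set (Quotient (colourSetoid f))
  str :=
    { (inferInstance : BooleanAlgebra (Set (Quotient (colourSetoid f)))) with
      c := fun i X => {q | ∃ s t : ι → U, Quotient.mk (colourSetoid f) s = q ∧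
        Quotient.mk (colourSetoid f) t ∈ X ∧ ∀ j, j ≠ i → s j = t j}
      d := fun i j => {q | ∃ s : ι → U, Quotient.mk (colourSetoid f) s = q ∧ s i = s j} }

/-- The set of classes of injective sequences of colour `n`. -/
def colourClass (f : (ι → U) → N) (n : N) : Set (Quotient (colourSetoid f)) :=
  {q | ∃ s, Quotient.mk (colourSetoid f) s = q ∧ Function.Injective s ∧ f s = n}

theorem mk_mem_colourClass {f : (ι → U) → N} {n : N} {s : ι → U} :
    Quotient.mk (colourSetoid f) s ∈ colourClass f n ↔ Function.Injective s ∧ f s = n := by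
  constructor
  · rintro ⟨t, ht, hinj, hcol⟩
    have h : colourSetoid f t s := Quotient.exact ht
    exact ⟨fun i j hij => hinj ((h.1 i j).2 hij), (h.2 hinj).symm.trans hcol⟩
  · exact fun h => ⟨s, rfl, h⟩

variable [DecidableEq ι]

theorem kernel_update {s t : ι → U} {i : ι} {u v : U}
    (h : ∀ k l, k ≠ i → l ≠ i → (s k = s l ↔ t k = t l))
    (huv : ∀ k, k ≠ i → (s k = u ↔ t k = v)) (k l : ι) :
    Function.update s i u k = Function.update s i u l ↔
      Function.update t i v k = Function.update t i v l := by
  by_cases hk : k = i <;> by_cases hl : l = i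
  · simp [hk, hl]
  · subst hk
    simpa [hl, eq_comm] using huv l hl
  · subst hl
    simpa [hk] using huv k hk
  · simpa [hk, hl] using h k l hk hl

/-- The back-and-forth property of similarity. -/
theorem IsGeneric.exists_update_similar {f : (ι → U) → N} (hf : IsGeneric f) {s t : ι → U}
    (hst : colourSetoid f s t) (i : ι) (u : U) :
    ∃ v, colourSetoid f (Function.update s i u) (Function.update t i v) := by
  by_cases hu : ∃ j, j ≠ i ∧ s j = u
  · obtain ⟨j, hj, rfl⟩ := hu
    refine ⟨t j, kernel_update (fun k l _ _ => hst.1 k l) fun k _ => hst.1 k j, fun hinj => ?_⟩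
    refine absurd (hinj (a₁ := j) (a₂ := i) ?_) hj
    simp [hj]
  · push Not at hu
    obtain ⟨v, hv, hcol⟩ := hf t i (f (Function.update s i u))
    exact ⟨v, kernel_update (fun k l _ _ => hst.1 k l) fun k hk =>
      iff_of_false (hu k hk) (hv k), fun _ => hcol.symm⟩

theorem IsGeneric.mk_mem_c {f : (ι → U) → N} (hf : IsGeneric f) (i : ι) (X : colourAlg f)
    (s : ι → U) : Quotient.mk (colourSetoid f) s ∈ (show Set _ from (colourAlg f).c i X) ↔
      ∃ u, Quotient.mk (colourSetoid f) (Function.update s i u) ∈ (show Set _ from X) := by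
  constructor
  · rintro ⟨s', t, hs', ht, hst⟩
    obtain ⟨u, hu⟩ := hf.exists_update_similar (Quotient.exact hs') i (t i)
    refine ⟨u, ?_⟩
    rw [← Quotient.sound hu]
    convert ht using 2
    ext j
    by_cases hj : j = i
    · subst hj
      simp
    · simpa [hj] using hst j hj
  · rintro ⟨u, hu⟩
    exact ⟨s, _, rfl, hu, fun j hj => by simp [hj]⟩

theorem IsGeneric.colourAlg_embeds {f : (ι → U) → N} (hf : IsGeneric f) :
    (colourAlg f).Embeds (fullSetAlg (Set.univ : Set (ι → U))) := by
  refine ⟨⟨fun X => {s | Quotient.mk (colourSetoid f) s.1 ∈ X}, fun _ _ => rfl, fun _ => rfl,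
    ?_, ?_⟩, ?_⟩
  · intro i X
    ext s
    refine (hf.mk_mem_c i X s.1).trans ⟨?_, ?_⟩
    · rintro ⟨u, hu⟩
      exact ⟨⟨Function.update s.1 i u, trivial⟩, hu, fun j hj => (Function.update_of_ne hj u s.1).symm⟩
    · rintro ⟨t, ht, hst⟩
      refine ⟨t.1 i, ?_⟩
      convert show Quotient.mk (colourSetoid f) t.1 ∈ X from ht using 2
      ext j
      by_cases hj : j = i
      · subst hj
        simp
      · simpa [hj] using hst j hj
  · intro i j
    ext s
    constructor
    · rintro ⟨t, ht, hij⟩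
      exact ((Quotient.exact ht : colourSetoid f t s.1).1 i j).1 hij
    · exact fun h => ⟨s.1, rfl, h⟩
  · intro X Y hXY
    ext q
    obtain ⟨s, rfl⟩ := Quotient.exists_rep q
    exact Set.ext_iff.1 hXY ⟨s, trivial⟩

theorem IsGeneric.c_colourClass_subset {f : (ι → U) → N} (hf : IsGeneric f) (i : ι) (n m : N) :
    (colourAlg f).c i (colourClass f n) ≤ (colourAlg f).c i (colourClass f m) := by
  intro q
  obtain ⟨s, rfl⟩ := Quotient.exists_rep q
  intro hq
  obtain ⟨u, hu⟩ := (hf.mk_mem_c i _ s).1 hq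
  refine (hf.mk_mem_c i _ s).2 ?_
  obtain ⟨v, hv, hcol⟩ := hf s i m
  refine ⟨v, mk_mem_colourClass.2 ⟨fun k l hkl => (mk_mem_colourClass.1 hu).1 ?_, hcol⟩⟩
  by_cases hk : k = i <;> by_cases hl : l = i
  · rw [hk, hl]
  · subst hk
    simp only [Function.update_self, Function.update_of_ne hl] at hkl
    exact absurd hkl.symm (hv l)
  · subst hl
    simp only [Function.update_self, Function.update_of_ne hk] at hkl
    exact absurd hkl (hv k)
  · simpa [hk, hl] using hkl

/-- A `κ`-closed set of classes cannot tell apart two values of another coordinate `i` that occur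
nowhere else: it suffices to destroy injectivity at `κ`, where the colours are not seen. -/
theorem IsGeneric.mem_of_closed [Infinite ι] {f : (ι → U) → N} (hf : IsGeneric f) {i κ : ι}
    (hκ : κ ≠ i) {Y : colourAlg f} (hY : (colourAlg f).c κ Y = Y) {s : ι → U} {u v : U}
    (hu : ∀ j, j ≠ i → s j ≠ u) (hv : ∀ j, j ≠ i → s j ≠ v)
    (h : Quotient.mk (colourSetoid f) (Function.update s i u) ∈ (show Set _ from Y)) :
    Quotient.mk (colourSetoid f) (Function.update s i v) ∈ (show Set _ from Y) := by
  obtain ⟨k, hk⟩ := Infinite.exists_notMem_finset {i, κ}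
  simp only [Finset.mem_insert, Finset.mem_singleton, not_or] at hk
  have key : ∀ t : ι → U, Quotient.mk (colourSetoid f) t ∈ (show Set _ from Y) ↔
      Quotient.mk (colourSetoid f) (Function.update t κ (t k)) ∈ (show Set _ from Y) := by
    intro t
    constructor
    · intro ht
      rw [← hY]
      refine (hf.mk_mem_c κ Y _).2 ⟨t κ, ?_⟩
      simpa using ht
    · intro ht
      rw [← hY]
      exact (hf.mk_mem_c κ Y _).2 ⟨_, ht⟩
  rw [key] at h ⊢
  rw [Function.update_of_ne hk.1] at h ⊢
  rw [Function.update_comm hκ.symm] at h ⊢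
  have hs : ∀ j, j ≠ i → ∃ l, l ≠ i ∧ Function.update s κ (s k) j = s l := by
    intro j hj
    by_cases hjκ : j = κ
    · subst hjκ
      exact ⟨k, hk.1, by simp⟩
    · exact ⟨j, hj, by simp [hjκ]⟩
  convert h using 1
  refine Quotient.sound ⟨kernel_update (fun _ _ _ _ => Iff.rfl) fun j hj => ?_, fun hinj => ?_⟩
  · obtain ⟨l, hl, he⟩ := hs j hj
    rw [he]
    exact iff_of_false (hv l hl) (hu l hl)
  · refine absurd (hinj (a₁ := κ) (a₂ := k) ?_) (Ne.symm hk.2)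
    simp [hk.1, hk.2, hκ]

/-- If there are too many colours to be indexed by the coordinates, then a homomorphism into
`κ`-closed elements would need more values of one coordinate than there are coordinates. -/
theorem IsGeneric.not_mem_Edc [Infinite ι] {f : (ι → U) → N} (hf : IsGeneric f)
    (hN : ∀ g : N → ι, ¬ Function.Injective g) (s₀ : ι → U)
    (hs₀ : Function.Injective s₀) : colourAlg f ∉ Edc.{u, max u w} ι := by
  rintro ⟨-, hE⟩
  obtain ⟨i⟩ : Nonempty ι := inferInstance
  obtain ⟨κ, hκ, h, hne, hcl⟩ := hE {i} (Set.finite_singleton i) (colourClass f (f s₀))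
    (Set.nonempty_iff_ne_empty.1 ⟨_, mk_mem_colourClass.2 ⟨hs₀, rfl⟩⟩)
  let y : N → Set (Quotient (colourSetoid f)) := fun n => h.toFun (colourClass f n)
  have hκi : κ ≠ i := hκ
  have hbot : ∀ X Y : Set (Quotient (colourSetoid f)), X ∩ Y = ∅ →
      (show Set (Quotient (colourSetoid f)) from h.toFun X) ∩ h.toFun Y = ∅ := by
    intro X Y hXY
    have h1 : Y ∪ Xᶜ = Xᶜ := Set.union_eq_right.2 fun q hq hq' =>
      (Set.eq_empty_iff_forall_notMem.1 hXY q) ⟨hq', hq⟩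
    have h2 : (show Set (Quotient (colourSetoid f)) from h.toFun Y) ∪ (h.toFun X : Set _)ᶜ =
        (h.toFun X : Set _)ᶜ := by
      have := h.map_sup Y Xᶜ
      rw [h.map_compl] at this
      exact this.symm.trans ((congrArg h.toFun h1).trans (h.map_compl X))
    refine Set.eq_empty_iff_forall_notMem.2 fun q hq => ?_
    exact (h2 ▸ Set.mem_union_left _ hq.2 : q ∈ (h.toFun X : Set _)ᶜ) hq.1
  have hdisj : ∀ n m q, q ∈ y n → q ∈ y m → n = m := by
    intro n m q hn hm
    by_contra hnm
    refine (Set.eq_empty_iff_forall_notMem.1 (hbot _ _ ?_)) q ⟨hn, hm⟩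
    refine Set.eq_empty_iff_forall_notMem.2 fun q => ?_
    obtain ⟨s, rfl⟩ := Quotient.exists_rep q
    rintro ⟨h1, h2⟩
    exact hnm ((mk_mem_colourClass.1 h1).2.symm.trans (mk_mem_colourClass.1 h2).2)
  have hall : ∀ n m s, Quotient.mk _ s ∈ y n →
      ∃ u, Quotient.mk (colourSetoid f) (Function.update s i u) ∈ y m := by
    intro n m s hs
    refine (hf.mk_mem_c i (y m) s).1 ?_
    have h1 : ∀ k, (colourAlg f).c i (y k) = h.toFun ((colourAlg f).c i (colourClass f k)) :=
      fun k => (h.map_c ⟨i, rfl⟩ (colourClass f k)).symm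
    rw [h1, le_antisymm (hf.c_colourClass_subset i m n) (hf.c_colourClass_subset i n m), ← h1]
    exact (hf.mk_mem_c i (y n) s).2 ⟨s i, by simpa using hs⟩
  -- By Cantor's theorem some witness avoids all other coordinates of the sequence.
  have hfresh : ∀ (s : ι → U) (u : N → U),
      (∀ n, Quotient.mk (colourSetoid f) (Function.update s i (u n)) ∈ y n) →
      ∃ n, ∀ j, j ≠ i → s j ≠ u n := by
    intro s u hu
    by_contra! hcon
    choose g hg1 hg2 using hcon
    refine hN g fun n m hnm => hdisj n m _ (hu n) ?_
    rw [← hg2 n, hnm, hg2 m]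
    exact hu m
  obtain ⟨q, hq⟩ := Set.nonempty_iff_ne_empty.2 hne
  obtain ⟨s, rfl⟩ := Quotient.exists_rep q
  choose u hu using fun m => hall (f s₀) m s hq
  obtain ⟨n, hn⟩ := hfresh s u hu
  -- Were `u n` the only such witness, all the `u m` would be entries of `update s i (u n)`, again
  -- contradicting Cantor's theorem.
  by_cases hex : ∃ m, m ≠ n ∧ ∀ j, j ≠ i → s j ≠ u m
  · obtain ⟨m, hmn, hm⟩ := hex
    exact hmn (hdisj _ _ _ (hu m) (hf.mem_of_closed hκi (hcl _) hn hm (hu n)))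
  · push Not at hex
    have : ∀ m, ∃ j, Function.update s i (u n) j = u m := by
      intro m
      by_cases hmn : m = n
      · exact ⟨i, by simp [hmn]⟩
      · obtain ⟨j, hj, he⟩ := hex m hmn
        exact ⟨j, by simp [hj, he]⟩
    choose g hg using this
    refine hN g fun a b hab => hdisj a b _ (hu a) ?_
    rw [← hg a, hab, hg b]
    exact hu b

end ColouredSequences

/-- A colouring: apply a linear functional that extends the sum of finitely supported sequences. -/
theorem exists_isGeneric (ι : Type u) [DecidableEq ι] :
    ∃ f : (ι → (ι → ZMod 2) × (ι → ZMod 2)) → (ι → ZMod 2), IsGeneric f := by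
  let E := (ι → ZMod 2) × (ι → ZMod 2)
  let incl : (ι →₀ E) →ₗ[ZMod 2] (ι → E) := Finsupp.lcoeFun
  obtain ⟨g, hg⟩ := incl.exists_leftInverse_of_injective
    (LinearMap.ker_eq_bot.2 DFunLike.coe_injective)
  let φ : (ι → E) →ₗ[ZMod 2] E := (Finsupp.lsum ℕ fun _ => LinearMap.id) ∘ₗ g
  have hφ : ∀ i (a : E), φ (Pi.single i a) = a := by
    intro i a
    have h1 : g (Pi.single i a) = Finsupp.single i a := by
      have := LinearMap.congr_fun hg (Finsupp.single i a)
      simpa [incl, Finsupp.single_eq_pi_single] using this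
    simp [φ, h1]
  refine ⟨fun s => (φ s).1, fun t i n => ?_⟩
  -- The first component of the new entry fixes the colour, the second is a diagonal argument.
  let u : E := (n - (φ t).1 + (t i).1, fun j => (t j).2 j + 1)
  refine ⟨u, fun j hj => ?_, ?_⟩
  · have := congrFun (congrArg Prod.snd hj) j
    simp [u] at this
  · have h1 : Function.update t i u = t + Pi.single i (u - t i) := by
      ext1 j
      by_cases hj : j = i
      · subst hj
        simp
      · simp [hj]
    change (φ (Function.update t i u)).1 = n
    rw [h1, map_add, hφ]
    change (φ t).1 + (n - (φ t).1 + (t i).1 - (t i).1) = n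
    abel

theorem exists_mem_RCA_not_mem_Edc (ι : Type u) [Infinite ι] :
    ∃ A : CylAlg.{u, max u v} ι, A ∈ RCA ι ∧ A ∉ Edc ι := by
  classical
  obtain ⟨f, hf⟩ := exists_isGeneric ι
  let F : (ι → ULift.{v} ((ι → ZMod 2) × (ι → ZMod 2))) → (ι → ZMod 2) :=
    fun s => f (ULift.down ∘ s)
  have hF : IsGeneric F := by
    intro t i n
    obtain ⟨u, hu, hcol⟩ := hf (ULift.down ∘ t) i n
    refine ⟨⟨u⟩, fun j hj => hu j (congrArg ULift.down hj), ?_⟩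
    rw [← hcol]
    simp only [F]
    congr 1
    ext1 j
    by_cases hj : j = i
    · subst hj
      simp
    · simp [hj]
  refine ⟨colourAlg F, ⟨_, Set.univ, ⟨{Set.univ}, by simp, by simp [space]⟩,
    hF.colourAlg_embeds⟩, hF.not_mem_Edc ?_ (fun i => ⟨(Pi.single i 1, 0)⟩) ?_⟩
  · intro g hg
    refine Function.cantor_injective (fun X : Set ι => g (X.indicator 1)) (hg.comp ?_)
    intro X Y hXY
    ext i
    have := congrFun hXY i
    by_cases hX : i ∈ X <;> by_cases hY : i ∈ Y <;> simp_all
  · intro i j hij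
    have := congrFun (congrArg (fun p => p.down.1) hij) i
    by_contra hne
    simp [hne] at this

/-! ### Arithmetic of cylindric algebras -/

namespace IsCylindric

variable {ι : Type u} {A : CylAlg.{u, w} ι}

theorem c_mono (hA : IsCylindric A) (i : ι) {x y : A} (h : x ≤ y) : A.c i x ≤ A.c i y := by
  rw [← sup_eq_right.2 h, hA.c_sup]
  exact le_sup_left

theorem c_compl_of_closed (hA : IsCylindric A) {i : ι} {x : A} (h : A.c i x = x) :
    A.c i xᶜ = xᶜ := by
  have := hA.c_compl_c i x
  rwa [h] at this

theorem c_bot (hA : IsCylindric A) (i : ι) : A.c i ⊥ = ⊥ := by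
  have h : A.c i ⊤ = ⊤ := top_le_iff.1 (hA.le_c i ⊤)
  simpa using hA.c_compl_of_closed h

theorem eq_bot_of_c_eq_bot (hA : IsCylindric A) {i : ι} {x : A} (h : A.c i x = ⊥) : x = ⊥ :=
  le_bot_iff.1 (h ▸ hA.le_c i x)

theorem c_inf_of_closed (hA : IsCylindric A) {i : ι} {y : A} (hy : A.c i y = y) (x : A) :
    A.c i (x ⊓ y) = A.c i x ⊓ y := by
  apply le_antisymm
  · refine le_inf (hA.c_mono i inf_le_left) ?_
    calc A.c i (x ⊓ y) ≤ A.c i y := hA.c_mono i inf_le_right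
      _ = y := hy
  · have h1 : A.c i x ≤ A.c i (x ⊓ y) ⊔ yᶜ := by
      calc A.c i x = A.c i ((x ⊓ y) ⊔ (x ⊓ yᶜ)) := by rw [sup_inf_inf_compl]
        _ = A.c i (x ⊓ y) ⊔ A.c i (x ⊓ yᶜ) := hA.c_sup ..
        _ ≤ A.c i (x ⊓ y) ⊔ A.c i yᶜ := sup_le_sup_left (hA.c_mono i inf_le_right) _
        _ = A.c i (x ⊓ y) ⊔ yᶜ := by rw [hA.c_compl_of_closed hy]
    calc A.c i x ⊓ y ≤ (A.c i (x ⊓ y) ⊔ yᶜ) ⊓ y := inf_le_inf_right _ h1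
      _ = A.c i (x ⊓ y) ⊓ y := by rw [inf_sup_right, compl_inf_self, sup_bot_eq]
      _ ≤ A.c i (x ⊓ y) := inf_le_left

theorem inf_closed (hA : IsCylindric A) {i : ι} {x y : A} (hx : A.c i x = x) (hy : A.c i y = y) :
    A.c i (x ⊓ y) = x ⊓ y := by
  rw [hA.c_inf_of_closed hy, hx]

theorem c_d_of_ne (hA : IsCylindric A) {k i j : ι} (hi : k ≠ i) (hj : k ≠ j) :
    A.c k (A.d i j) = A.d i j := by
  by_cases hij : i = j
  · subst hij
    rw [hA.d_self]
    exact top_le_iff.1 (hA.le_c k ⊤)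
  · rw [← hA.c_d_inf_d i k j hi.symm hj hij, hA.c_c]

theorem d_inf_d_le (hA : IsCylindric A) (i j k : ι) : A.d i j ⊓ A.d j k ≤ A.d i k := by
  by_cases hij : i = j
  · subst hij
    exact inf_le_right
  by_cases hjk : j = k
  · subst hjk
    exact inf_le_left
  by_cases hik : i = k
  · subst hik
    rw [hA.d_self]
    exact le_top
  rw [← hA.c_d_inf_d i j k hij hjk hik]
  exact hA.le_c j _

end IsCylindric

namespace CylAlg

variable {ι : Type u}

/-- The substitution operator `s^i_k`, which replaces coordinate `i` by coordinate `k`; it is only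
meaningful for `i ≠ k`. -/
def sub (A : CylAlg.{u, w} ι) (i k : ι) (x : A) : A := A.c i (A.d i k ⊓ x)

/-- The simultaneous substitution of `v i` for the coordinates `i` in the list `l`. It is built from
single substitutions and therefore only meaningful if `l` has no duplicates and `v` takes `l` out
of `l`. -/
def subst (A : CylAlg.{u, w} ι) (v : ι → ι) (l : List ι) (x : A) : A :=
  l.foldr (fun i y => A.sub i (v i) y) x

@[simp] theorem subst_cons (A : CylAlg.{u, w} ι) (v : ι → ι) (i : ι) (l : List ι) (x : A) :
    A.subst v (i :: l) x = A.sub i (v i) (A.subst v l x) := rfl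

theorem subst_append_singleton (A : CylAlg.{u, w} ι) (v : ι → ι) (l : List ι) (i : ι) (x : A) :
    A.subst v (l ++ [i]) x = A.subst v l (A.sub i (v i) x) := by
  simp [subst]

theorem subst_congr (A : CylAlg.{u, w} ι) {v v' : ι → ι} {l : List ι} (h : ∀ i ∈ l, v i = v' i)
    (x : A) : A.subst v l x = A.subst v' l x := by
  induction l with
  | nil => rfl
  | cons i l ih =>
    rw [subst_cons, subst_cons, h i (by simp), ih fun j hj => h j (by simp [hj])]

end CylAlg

namespace IsCylindric

variable {ι : Type u} {A : CylAlg.{u, w} ι}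

theorem sub_sup (hA : IsCylindric A) (i k : ι) (x y : A) :
    A.sub i k (x ⊔ y) = A.sub i k x ⊔ A.sub i k y := by
  simp only [CylAlg.sub, inf_sup_left, hA.c_sup]

theorem sub_compl (hA : IsCylindric A) {i k : ι} (hik : i ≠ k) (x : A) :
    A.sub i k xᶜ = (A.sub i k x)ᶜ := by
  refine (IsCompl.compl_eq ⟨?_, ?_⟩).symm
  · have h1 : A.c i (A.d i k ⊓ x ⊓ A.c i (A.d i k ⊓ xᶜ)) = A.sub i k x ⊓ A.sub i k xᶜ :=
      hA.c_inf_of_closed (hA.c_c i _) _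
    rw [disjoint_iff, ← h1, inf_right_comm, hA.d_inf_c i k _ hik, inf_assoc, compl_inf_self,
      inf_bot_eq, hA.c_bot]
  · rw [codisjoint_iff, ← hA.sub_sup, sup_compl_eq_top, CylAlg.sub, inf_top_eq, hA.c_d i k hik]

theorem sub_of_closed (hA : IsCylindric A) {i k : ι} (hik : i ≠ k) {x : A} (hx : A.c i x = x) :
    A.sub i k x = x := by
  rw [CylAlg.sub, hA.c_inf_of_closed hx, hA.c_d i k hik, top_inf_eq]

theorem c_sub (hA : IsCylindric A) {i j k : ι} (hij : j ≠ i) (hjk : j ≠ k) (x : A) :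
    A.c j (A.sub i k x) = A.sub i k (A.c j x) := by
  rw [CylAlg.sub, CylAlg.sub, hA.c_comm, inf_comm, hA.c_inf_of_closed (hA.c_d_of_ne hij hjk),
    inf_comm]

theorem sub_comm (hA : IsCylindric A) {i j k l : ι} (hil : i ≠ l) (hij : i ≠ j) (hjk : j ≠ k) (x : A) :
    A.sub i k (A.sub j l x) = A.sub j l (A.sub i k x) := by
  have h : ∀ {i j k l : ι} (_ : i ≠ j) (_ : j ≠ k),
      A.sub i k (A.sub j l x) = A.c i (A.c j (A.d j l ⊓ x ⊓ A.d i k)) := by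
    intro i j k l hij hjk
    rw [hA.c_inf_of_closed (hA.c_d_of_ne hij.symm hjk), inf_comm]
    rfl
  rw [h hij hjk, h hij.symm hil, hA.c_comm, inf_comm _ (A.d j l), inf_assoc,
    inf_comm x]

theorem c_sub_right (hA : IsCylindric A) {i k : ι} (hik : i ≠ k) {x : A} (hx : A.c k x = x) :
    A.c k (A.sub i k x) = A.c i x := by
  rw [CylAlg.sub, hA.c_comm, hA.c_inf_of_closed hx, hA.d_symm, hA.c_d k i hik.symm, top_inf_eq]

theorem sub_d (hA : IsCylindric A) [DecidableEq ι] {i k : ι} (hik : i ≠ k) (p q : ι) :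
    A.sub i k (A.d p q) = A.d (if p = i then k else p) (if q = i then k else q) := by
  have h : ∀ q, q ≠ i → A.sub i k (A.d i q) = A.d k q := by
    intro q hq
    by_cases hkq : k = q
    · subst hkq
      rw [CylAlg.sub, inf_idem, hA.c_d i k hik, hA.d_self]
    · rw [CylAlg.sub, hA.d_symm i k, hA.c_d_inf_d k i q hik.symm hq.symm hkq]
  by_cases hp : p = i <;> by_cases hq : q = i
  · subst hp hq
    simp only [if_true]
    rw [hA.d_self, hA.d_self]
    exact hA.sub_of_closed hik (top_le_iff.1 (hA.le_c _ _))
  · subst hp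
    simpa [hq] using h q hq
  · subst hq
    rw [hA.d_symm]
    simp only [if_true, if_neg hp]
    rw [h p hp, hA.d_symm]
  · simp only [if_neg hp, if_neg hq]
    exact hA.sub_of_closed hik (hA.c_d_of_ne (Ne.symm hp) (Ne.symm hq))

theorem d_inf_sub_le (hA : IsCylindric A) {i k l : ι} (hik : i ≠ k) (hil : i ≠ l) (x : A) :
    A.d k l ⊓ A.sub i k x ≤ A.sub i l x := by
  rw [CylAlg.sub, inf_comm, ← hA.c_inf_of_closed (hA.c_d_of_ne hik hil)]
  refine hA.c_mono i (le_inf ?_ (inf_le_left.trans inf_le_right))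
  exact le_trans (le_inf (inf_le_left.trans inf_le_left) inf_le_right) (hA.d_inf_d_le i k l)

variable {v : ι → ι} {l : List ι}

theorem subst_sup (hA : IsCylindric A) (v : ι → ι) (l : List ι) (x y : A) :
    A.subst v l (x ⊔ y) = A.subst v l x ⊔ A.subst v l y := by
  induction l with
  | nil => rfl
  | cons i l ih => rw [CylAlg.subst_cons, ih, hA.sub_sup]; rfl

theorem subst_mono (hA : IsCylindric A) (v : ι → ι) (l : List ι) {x y : A} (h : x ≤ y) :
    A.subst v l x ≤ A.subst v l y := by
  rw [← sup_eq_right.2 h, hA.subst_sup]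
  exact le_sup_left

theorem subst_compl (hA : IsCylindric A) (h : ∀ i ∈ l, v i ∉ l) (x : A) :
    A.subst v l xᶜ = (A.subst v l x)ᶜ := by
  have h' : ∀ i ∈ l, i ≠ v i := fun i hi he => h i hi (he ▸ hi)
  clear h
  induction l with
  | nil => rfl
  | cons i l ih =>
    rw [CylAlg.subst_cons, ih fun j hj => h' j (by simp [hj]), hA.sub_compl (h' i (by simp))]
    rfl

theorem subst_inf (hA : IsCylindric A) (h : ∀ i ∈ l, v i ∉ l) (x y : A) :
    A.subst v l (x ⊓ y) = A.subst v l x ⊓ A.subst v l y := by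
  rw [← compl_inj_iff, ← hA.subst_compl h, compl_inf, hA.subst_sup, hA.subst_compl h,
    hA.subst_compl h, compl_inf]

theorem c_subst (hA : IsCylindric A) {j : ι} (hj : j ∉ l) (hjv : ∀ i ∈ l, j ≠ v i) (x : A) :
    A.c j (A.subst v l x) = A.subst v l (A.c j x) := by
  induction l with
  | nil => rfl
  | cons i l ih =>
    simp only [List.mem_cons, not_or] at hj
    rw [CylAlg.subst_cons, hA.c_sub hj.1 (hjv i (by simp)),
      ih hj.2 fun k hk => hjv k (by simp [hk])]
    rfl

theorem subst_of_closed (hA : IsCylindric A) (h : ∀ i ∈ l, v i ∉ l) {x : A}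
    (hx : ∀ i ∈ l, A.c i x = x) : A.subst v l x = x := by
  have h' : ∀ i ∈ l, i ≠ v i := fun i hi he => h i hi (he ▸ hi)
  clear h
  induction l with
  | nil => rfl
  | cons i l ih =>
    rw [CylAlg.subst_cons, ih (fun j hj => hx j (by simp [hj])) (fun j hj => h' j (by simp [hj])),
      hA.sub_of_closed (h' i (by simp)) (hx i (by simp))]

theorem subst_perm (hA : IsCylindric A) {l' : List ι} (hp : l.Perm l') (hl : l.Nodup)
    (h : ∀ i ∈ l, v i ∉ l) (x : A) : A.subst v l x = A.subst v l' x := by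
  have h' : ∀ i ∈ l, ∀ j ∈ l, i ≠ v j := fun i hi j hj he => h j hj (he ▸ hi)
  clear h
  induction hp with
  | nil => rfl
  | cons i _ ih =>
    rw [CylAlg.subst_cons, CylAlg.subst_cons, ih (List.nodup_cons.1 hl).2 fun j hj k hk =>
      h' j (by simp [hj]) k (by simp [hk])]
  | swap i j l =>
    simp only [List.nodup_cons, List.mem_cons, not_or] at hl
    simp only [CylAlg.subst_cons]
    exact hA.sub_comm (h' _ (by simp) _ (by simp)) hl.1.1 (h' _ (by simp) _ (by simp)) _
  | trans h1 _ ih1 ih2 =>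
    rw [ih1 hl h', ih2 (h1.nodup_iff.1 hl) fun i hi j hj =>
      h' i (h1.mem_iff.2 hi) j (h1.mem_iff.2 hj)]

theorem subst_d (hA : IsCylindric A) [DecidableEq ι] (hl : l.Nodup) (h : ∀ i ∈ l, v i ∉ l)
    (p q : ι) :
    A.subst v l (A.d p q) = A.d (if p ∈ l then v p else p) (if q ∈ l then v q else q) := by
  have h' : ∀ i ∈ l, ∀ j ∈ l, v j ≠ i := fun i hi j hj he => h j hj (he ▸ hi)
  clear h
  induction l with
  | nil => simp [CylAlg.subst]
  | cons i l ih =>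
    rw [List.nodup_cons] at hl
    rw [CylAlg.subst_cons, ih hl.2 fun j hj k hk => h' j (by simp [hj]) k (by simp [hk]),
      hA.sub_d (h' i (by simp) i (by simp)).symm]
    have key : ∀ p, (if (if p ∈ l then v p else p) = i then v i else
        (if p ∈ l then v p else p)) = if p ∈ i :: l then v p else p := by
      intro p
      by_cases hp : p ∈ l
      · simp [hp, h' i (by simp) p (by simp [hp])]
      · by_cases hpi : p = i
        · subst hpi
          simp [hp]
        · simp [hp, hpi]
    rw [key, key]

theorem eq_bot_of_subst_eq_bot (hA : IsCylindric A) (hl : l.Nodup) (h : ∀ i ∈ l, v i ∉ l)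
    (hv : ∀ i ∈ l, ∀ j ∈ l, v i = v j → i = j) {x : A} (hx : ∀ i ∈ l, A.c (v i) x = x)
    (h0 : A.subst v l x = ⊥) : x = ⊥ := by
  have h' : ∀ i ∈ l, ∀ j ∈ l, v j ≠ i := fun i hi j hj he => h j hj (he ▸ hi)
  clear h
  induction l with
  | nil => exact h0
  | cons i l ih =>
    rw [List.nodup_cons] at hl
    refine ih hl.2 (fun j hj k hk => hv j (by simp [hj]) k (by simp [hk]))
      (fun j hj => hx j (by simp [hj])) ?_ fun j hj k hk => h' j (by simp [hj]) k (by simp [hk])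
    have hcl : A.c (v i) (A.subst v l x) = A.subst v l x := by
      rw [hA.c_subst (fun hm => h' (v i) (by simp [hm]) i (by simp) rfl), hx i (by simp)]
      intro j hj he
      have := hv i (by simp) j (by simp [hj]) he
      exact hl.1 (this ▸ hj)
    have h2 := hA.c_sub_right (h' i (by simp) i (by simp)).symm hcl
    rw [CylAlg.subst_cons] at h0
    rw [h0, hA.c_bot] at h2
    exact hA.eq_bot_of_c_eq_bot h2.symm

/-! ### Simultaneous substitution with one coordinate singled out -/

variable [DecidableEq ι] {Γ : Finset ι} {i : ι}

theorem subst_toList_eq (hA : IsCylindric A) (hi : i ∈ Γ) (h : ∀ j ∈ Γ, v j ∉ Γ) (x : A) :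
    A.subst v Γ.toList x = A.subst v (Γ.erase i).toList (A.sub i (v i) x) := by
  rw [← CylAlg.subst_append_singleton]
  refine hA.subst_perm ?_ Γ.nodup_toList (by simpa using h) x
  have h1 : Γ.toList.Perm (i :: (Γ.erase i).toList) := by
    have := Finset.toList_cons (s := Γ.erase i) (a := i) (by simp)
    rwa [Finset.cons_eq_insert, Finset.insert_erase hi] at this
  exact h1.trans (List.perm_append_singleton i _).symm

theorem subst_update (A : CylAlg.{u, w} ι) (v : ι → ι) (Γ : Finset ι) (i k : ι) (x : A) :
    A.subst (Function.update v i k) (Γ.erase i).toList x = A.subst v (Γ.erase i).toList x := by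
  refine A.subst_congr (fun j hj => ?_) x
  simp only [Finset.mem_toList, Finset.mem_erase] at hj
  simp [hj.1]

theorem update_notMem {k : ι} (h : ∀ j ∈ Γ, v j ∉ Γ) (hk : k ∉ Γ) :
    ∀ j ∈ Γ, Function.update v i k j ∉ Γ := by
  intro j hj
  by_cases hji : j = i
  · subst hji
    simpa using hk
  · simpa [hji] using h j hj

theorem subst_update_c (hA : IsCylindric A) (hi : i ∈ Γ) (h : ∀ j ∈ Γ, v j ∉ Γ) {k : ι}
    (hk : k ∉ Γ) (x : A) :
    A.subst (Function.update v i k) Γ.toList (A.c i x) = A.subst v Γ.toList (A.c i x) := by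
  rw [hA.subst_toList_eq hi h, hA.subst_toList_eq hi (update_notMem h hk), subst_update,
    hA.sub_of_closed (ne_of_mem_of_not_mem hi (h i hi)) (hA.c_c i x),
    hA.sub_of_closed (ne_of_mem_of_not_mem hi (update_notMem h hk i hi)) (hA.c_c i x)]

/-- A fresh coordinate `k` serves as a witness for the cylindrification `c i`. -/
theorem c_subst_update (hA : IsCylindric A) (hi : i ∈ Γ) (h : ∀ j ∈ Γ, v j ∉ Γ) {k : ι}
    (hk : k ∉ Γ) (hkv : ∀ j ∈ Γ, k ≠ v j) {x : A} (hx : A.c k x = x) :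
    A.c k (A.subst (Function.update v i k) Γ.toList x) = A.subst v Γ.toList (A.c i x) := by
  have hik : i ≠ k := fun he => hk (he ▸ hi)
  rw [hA.subst_toList_eq hi h, hA.subst_toList_eq hi (update_notMem h hk), subst_update,
    hA.c_subst (by simp [hk]) (fun j hj => hkv j (by simp at hj; exact hj.2)),
    Function.update_self, hA.c_sub_right hik hx,
    hA.sub_of_closed (ne_of_mem_of_not_mem hi (h i hi)) (hA.c_c i x)]

theorem d_inf_subst_le (hA : IsCylindric A) (hi : i ∈ Γ) (h : ∀ j ∈ Γ, v j ∉ Γ) {k : ι}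
    (hk : k ∉ Γ) (x : A) :
    A.d (v i) k ⊓ A.subst v Γ.toList x ≤ A.subst (Function.update v i k) Γ.toList x := by
  have hlist : ∀ j ∈ (Γ.erase i).toList, v j ∉ (Γ.erase i).toList := by
    intro j hj
    simp only [Finset.mem_toList, Finset.mem_erase] at hj ⊢
    exact fun hv => h j hj.2 hv.2
  have hd : A.subst v (Γ.erase i).toList (A.d (v i) k) = A.d (v i) k := by
    refine hA.subst_of_closed hlist fun j hj => ?_
    simp only [Finset.mem_toList, Finset.mem_erase] at hj
    exact hA.c_d_of_ne (fun he => h i hi (he ▸ hj.2)) fun he => hk (he ▸ hj.2)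
  rw [hA.subst_toList_eq hi h, hA.subst_toList_eq hi (update_notMem h hk), subst_update, ← hd,
    ← hA.subst_inf hlist, Function.update_self]
  exact hA.subst_mono v _
    (hA.d_inf_sub_le (ne_of_mem_of_not_mem hi (h i hi)) (ne_of_mem_of_not_mem hi hk) x)

end IsCylindric

/-! ### Dilating endomorphisms -/

/-- `h` is an endomorphism of the `Γ`-reduct of `A`. -/
structure IsReductEndo {ι : Type u} (A : CylAlg.{u, w} ι) (Γ : Set ι) (h : A → A) : Prop where
  map_sup : ∀ x y : A, h (x ⊔ y) = h x ⊔ h y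
  map_compl : ∀ x : A, h xᶜ = (h x)ᶜ
  map_c : ∀ i ∈ Γ, ∀ x : A, h (A.c i x) = A.c i (h x)
  map_d : ∀ i ∈ Γ, ∀ j ∈ Γ, h (A.d i j) = A.d i j

/-- Iterating endo-dimension-complementedness frees any finite number of coordinates at once. -/
theorem exists_reductEndo_of_mem_Edc {ι : Type u} {A : CylAlg.{u, w} ι} (hA : A ∈ Edc ι)
    (Γ : Finset ι) {x : A} (hx : x ≠ ⊥) (n : ℕ) :
    ∃ K : Finset ι, K.card = n ∧ Disjoint Γ K ∧ ∃ h : A → A, IsReductEndo A Γ h ∧ h x ≠ ⊥ ∧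
      ∀ k ∈ K, ∀ a, A.c k (h a) = h a := by
  classical
  induction n with
  | zero =>
    exact ⟨∅, rfl, Finset.disjoint_empty_right _, id,
      ⟨fun _ _ => rfl, fun _ => rfl, fun _ _ _ => rfl, fun _ _ _ _ => rfl⟩, hx, by simp⟩
  | succ n ih =>
    obtain ⟨K, hK, hdisj, h, hh, hne, hcl⟩ := ih
    obtain ⟨κ, hκ, g, hg, hgcl⟩ := hA.2 (Γ ∪ K : Finset ι) (Finset.finite_toSet _) (h x) hne
    simp only [Finset.coe_union, Set.mem_union, Finset.mem_coe, not_or] at hκ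
    refine ⟨insert κ K, ?_, ?_, g.toFun ∘ h, ⟨?_, ?_, ?_, ?_⟩, hg, ?_⟩
    · rw [Finset.card_insert_of_notMem hκ.2, hK]
    · rw [Finset.disjoint_insert_right]
      exact ⟨hκ.1, hdisj⟩
    · intro x y
      exact (congrArg g.toFun (hh.map_sup x y)).trans (g.map_sup _ _)
    · intro x
      exact (congrArg g.toFun (hh.map_compl x)).trans (g.map_compl _)
    · intro i hi x
      have hi' : i ∈ Γ := hi
      exact (congrArg g.toFun (hh.map_c i hi x)).trans (g.map_c ⟨i, by simp [hi']⟩ _)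
    · intro i hi j hj
      have hi' : i ∈ Γ := hi
      have hj' : j ∈ Γ := hj
      exact (congrArg g.toFun (hh.map_d i hi j hj)).trans
        (g.map_d ⟨i, by simp [hi']⟩ ⟨j, by simp [hj']⟩)
    · intro k hk a
      rcases Finset.mem_insert.1 hk with rfl | hk
      · exact hgcl _
      · refine (g.map_c ⟨k, by simp [hk]⟩ _).symm.trans (congrArg g.toFun (hcl k hk a))

/-! ### Henkin terms and Henkin valuations -/

/-- Constants for a Henkin construction over the finite set `Γ` of coordinates: `base i` is an
initial value of coordinate `i`, and `wit i a v` is a witness, in place of coordinate `i`, for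
the statement that the assignment `v` satisfies `c_i a`. -/
inductive HenkinTerm {ι : Type u} (Γ : Finset ι) (A : Type w) : Type (max u w)
  | base (i : ι) : HenkinTerm Γ A
  | wit (i : ι) (a : A) (v : Γ → HenkinTerm Γ A) : HenkinTerm Γ A

namespace HenkinTerm

variable {ι : Type u} {Γ : Finset ι} {A : Type w}

/-- The nesting depth of witnesses. -/
def depth : HenkinTerm Γ A → ℕ
  | base _ => 0
  | wit _ _ v => (Finset.univ.sup fun j => depth (v j)) + 1

theorem depth_lt (i : ι) (a : A) (v : Γ → HenkinTerm Γ A) (j : Γ) :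
    (v j).depth < (wit i a v).depth := by
  rw [depth]
  exact Nat.lt_succ_of_le (Finset.le_sup (f := fun j => depth (v j)) (Finset.mem_univ j))

end HenkinTerm

open HenkinTerm

/-- `F a v` is read as "the assignment `v` satisfies `a`" and `E s t` as "`s = t`". The clauses
express, for all terms in the set `T`, that this describes a representation of the `Γ`-reduct
of `A` in which `x` is satisfied by the base assignment. -/
structure IsHenkin {ι : Type u} [DecidableEq ι] (A : CylAlg.{u, w} ι) (Γ : Finset ι) (x : A)
    (T : Set (HenkinTerm Γ A.carrier)) (F : A → (Γ → HenkinTerm Γ A.carrier) → Prop)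
    (E : HenkinTerm Γ A.carrier → HenkinTerm Γ A.carrier → Prop) : Prop where
  sup : ∀ v, (∀ j, v j ∈ T) → ∀ a b : A, F (a ⊔ b) v ↔ F a v ∨ F b v
  compl : ∀ v, (∀ j, v j ∈ T) → ∀ a : A, F aᶜ v ↔ ¬ F a v
  c_update : ∀ v, (∀ j, v j ∈ T) → ∀ (i : Γ) (a : A), ∀ t ∈ T,
    F (A.c i a) v → F (A.c i a) (Function.update v i t)
  le_c : ∀ v, (∀ j, v j ∈ T) → ∀ (i : Γ) (a : A), F a v → F (A.c i a) v
  witness : ∀ v, (∀ j, v j ∈ T) → ∀ (i : Γ) (a : A), wit i.1 a v ∈ T →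
    F (A.c i a) v → F a (Function.update v i (wit i.1 a v))
  d : ∀ v, (∀ j, v j ∈ T) → ∀ i j : Γ, F (A.d i j) v ↔ E (v i) (v j)
  refl : ∀ t ∈ T, E t t
  symm : ∀ s ∈ T, ∀ t ∈ T, E s t → E t s
  trans : ∀ r ∈ T, ∀ s ∈ T, ∀ t ∈ T, E r s → E s t → E r t
  congr : ∀ v, (∀ j, v j ∈ T) → ∀ (i : Γ) (a : A), ∀ t ∈ T,
    E (v i) t → F a v → F a (Function.update v i t)
  base : F x fun i => base i.1

/-- A nonzero element lies in an ultrafilter, given by its membership predicate. -/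
theorem exists_ultrafilter_of_ne_bot {B : Type w} [BooleanAlgebra B] {p : B} (hp : p ≠ ⊥) :
    ∃ u : B → Prop, u p ∧ (∀ x y, u (x ⊔ y) ↔ u x ∨ u y) ∧ (∀ x, u xᶜ ↔ ¬ u x) ∧
      ∀ x y, x ≤ y → u x → u y := by
  obtain ⟨J, hJ, hIJ, hdis⟩ := DistribLattice.prime_ideal_of_disjoint_filter_ideal
    (F := Order.PFilter.principal p) (I := Order.Ideal.principal ⊥) (by
      rw [Set.disjoint_left]
      intro y hy hy'
      have h1 : p ≤ y := Order.PFilter.mem_principal.1 hy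
      have h2 : y = ⊥ := le_bot_iff.1 (Order.Ideal.mem_principal.1 hy')
      exact hp (le_bot_iff.1 (h2 ▸ h1)))
  have hpJ : p ∉ J := fun h => Set.disjoint_left.1 hdis (Order.PFilter.mem_principal.2 le_rfl) h
  refine ⟨fun x => x ∉ J, hpJ, fun x y => ?_, fun x => ?_, fun x y hxy hx hy => hx (J.lower hxy hy)⟩
  · rw [← not_and_or, not_iff_not]
    exact Order.Ideal.sup_mem_iff
  · constructor
    · exact fun h h' => h ((hJ.mem_or_compl_mem (x := x)).resolve_left h')
    · intro h h'
      rw [not_not] at h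
      apply hpJ
      refine J.lower le_top ?_
      rw [← sup_compl_eq_top (x := x)]
      exact Order.Ideal.sup_mem h h'

section FiniteStage

variable {ι : Type u} [DecidableEq ι] {A : CylAlg.{u, w} ι} {Γ : Finset ι}

/-- The assignment `v` of terms, with terms read as coordinates by `ρ`. -/
def coordMap (ρ : HenkinTerm Γ A.carrier → ι) (v : Γ → HenkinTerm Γ A.carrier) (i : ι) : ι :=
  if hi : i ∈ Γ then ρ (v ⟨i, hi⟩) else i

theorem coordMap_apply (ρ : HenkinTerm Γ A.carrier → ι) (v : Γ → HenkinTerm Γ A.carrier) (i : Γ) :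
    coordMap ρ v i = ρ (v i) := by
  simp [coordMap]

theorem coordMap_update (ρ : HenkinTerm Γ A.carrier → ι) (v : Γ → HenkinTerm Γ A.carrier) (i : Γ)
    (t : HenkinTerm Γ A.carrier) :
    coordMap ρ (Function.update v i t) = Function.update (coordMap ρ v) i (ρ t) := by
  ext1 j
  by_cases hj : j ∈ Γ
  · by_cases hji : j = i
    · subst hji
      simp [coordMap]
    · have : (⟨j, hj⟩ : Γ) ≠ i := fun h => hji (congrArg Subtype.val h)
      simp [coordMap, hj, hji, this]
  · have : j ≠ i := fun h => hj (h ▸ i.2)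
    simp [coordMap, hj, this]

variable {ρ : HenkinTerm Γ A.carrier → ι} {T : Finset (HenkinTerm Γ A.carrier)} {h : A → A}

theorem coordMap_notMem (hρ : ∀ t ∈ T, ρ t ∉ Γ) {v : Γ → HenkinTerm Γ A.carrier}
    (hv : ∀ j, v j ∈ T) : ∀ j ∈ Γ, coordMap ρ v j ∉ Γ := by
  intro j hj
  rw [coordMap_apply ρ v ⟨j, hj⟩]
  exact hρ _ (hv _)

/-- A coordinate that is free in the values of `h` is free after substitution too, unless it is
the name of one of the terms substituted. -/
theorem c_subst_coordMap (hA : IsCylindric A) (hρ : ∀ t ∈ T, ρ t ∉ Γ) (hinj : Set.InjOn ρ T)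
    (hcl : ∀ t ∈ T, ∀ a, A.c (ρ t) (h a) = h a) {v : Γ → HenkinTerm Γ A.carrier}
    (hv : ∀ j, v j ∈ T) {t : HenkinTerm Γ A.carrier} (ht : t ∈ T) (hvt : ∀ j, v j ≠ t) (a : A) :
    A.c (ρ t) (A.subst (coordMap ρ v) Γ.toList (h a)) =
      A.subst (coordMap ρ v) Γ.toList (h a) := by
  rw [hA.c_subst (by simpa using hρ t ht), hcl t ht]
  intro j hj
  rw [Finset.mem_toList] at hj
  rw [coordMap_apply ρ v ⟨j, hj⟩]
  exact fun he => hvt _ (hinj (hv _) ht he.symm)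

/-- Some nonzero element forces all witnesses in `T` to do their job. Taken in order of depth, each
witness `w` names a coordinate that is free in the element `q` obtained so far, so that intersecting
`q` with `z ⊔ (c z)ᶜ`, where `c` is the cylindrification at that coordinate, cannot give `⊥`. -/
theorem exists_ne_bot_le_witness (hA : IsCylindric A) (hρ : ∀ t ∈ T, ρ t ∉ Γ)
    (hinj : Set.InjOn ρ T) (hcl : ∀ t ∈ T, ∀ a, A.c (ρ t) (h a) = h a)
    (hbase : ∀ i ∈ Γ, base i ∈ T) {x : A} (hx : h x ≠ ⊥) :
    ∃ q : A, q ≠ ⊥ ∧ q ≤ A.subst (coordMap ρ fun i => base i.1) Γ.toList (h x) ∧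
      ∀ (i : Γ) (a : A) (v : Γ → HenkinTerm Γ A.carrier), (∀ j, v j ∈ T) → wit i.1 a v ∈ T →
        q ⊓ A.c (ρ (wit i.1 a v))
            (A.subst (coordMap ρ (Function.update v i (wit i.1 a v))) Γ.toList (h a)) ≤
          A.subst (coordMap ρ (Function.update v i (wit i.1 a v))) Γ.toList (h a) := by
  classical
  have main : ∀ s : Finset (HenkinTerm Γ A.carrier), s ⊆ T →
      ∃ q : A, q ≠ ⊥ ∧ q ≤ A.subst (coordMap ρ fun i => base i.1) Γ.toList (h x) ∧
        (∀ (i : Γ) (a : A) (v : Γ → HenkinTerm Γ A.carrier), (∀ j, v j ∈ T) → wit i.1 a v ∈ s →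
          q ⊓ A.c (ρ (wit i.1 a v))
              (A.subst (coordMap ρ (Function.update v i (wit i.1 a v))) Γ.toList (h a)) ≤
            A.subst (coordMap ρ (Function.update v i (wit i.1 a v))) Γ.toList (h a)) ∧
        ∀ t ∈ T, t ∉ s → (∀ w ∈ s, w.depth ≤ t.depth) → (∀ i, t ≠ base i) → A.c (ρ t) q = q := by
    intro s
    induction s using Finset.induction_on_max_value (fun t : HenkinTerm Γ A.carrier => t.depth) with
    | empty =>
      intro _
      refine ⟨_, fun h0 => hx (hA.eq_bot_of_subst_eq_bot Γ.nodup_toList ?_ ?_ ?_ h0), le_rfl,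
        by simp, fun t ht _ _ htb => ?_⟩
      · simpa using coordMap_notMem hρ (v := fun i : Γ => base i.1) fun j => hbase _ j.2
      · intro i hi j hj hij
        rw [Finset.mem_toList] at hi hj
        rw [coordMap_apply ρ _ ⟨i, hi⟩, coordMap_apply ρ _ ⟨j, hj⟩] at hij
        simpa using hinj (hbase i hi) (hbase j hj) hij
      · intro i hi
        rw [Finset.mem_toList] at hi
        rw [coordMap_apply ρ _ ⟨i, hi⟩]
        exact hcl _ (hbase i hi) x
      · exact c_subst_coordMap hA hρ hinj hcl (fun j => hbase _ j.2) ht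
          (fun j he => htb _ he.symm) x
    | insert w s hws hmax ih =>
      intro hsT
      have hwT : w ∈ T := hsT (Finset.mem_insert_self w s)
      obtain ⟨q, hq0, hqx, hqw, hqc⟩ := ih fun t ht => hsT (Finset.mem_insert_of_mem ht)
      by_cases hw : ∃ (i : Γ) (a : A) (v : Γ → HenkinTerm Γ A.carrier),
          (∀ j, v j ∈ T) ∧ w = wit i.1 a v
      · obtain ⟨i, a, v, hv, rfl⟩ := hw
        set w : HenkinTerm Γ A.carrier := wit i.1 a v with hwdef
        set z : A := A.subst (coordMap ρ (Function.update v i w)) Γ.toList (h a) with hz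
        have hqcw : A.c (ρ w) q = q := hqc w hwT hws hmax fun j => by simp [hwdef]
        refine ⟨q ⊓ (z ⊔ (A.c (ρ w) z)ᶜ), fun h0 => hq0 ?_, inf_le_left.trans hqx, ?_, ?_⟩
        · have h1 : A.c (ρ w) ((z ⊔ (A.c (ρ w) z)ᶜ) ⊓ q) = q := by
            rw [hA.c_inf_of_closed hqcw, hA.c_sup, hA.c_compl_c, sup_compl_eq_top, top_inf_eq]
          rw [← h1, inf_comm, h0, hA.c_bot]
        · intro i' a' v' hv' hmem
          rcases Finset.mem_insert.1 hmem with heq | hmem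
          · obtain ⟨h1, h2, h3⟩ : i = i' ∧ a = a' ∧ v = v' := by
              rw [hwdef, wit.injEq] at heq
              exact ⟨Subtype.ext heq.1.symm, heq.2.1.symm, heq.2.2.symm⟩
            subst h1 h2 h3
            rw [inf_assoc, inf_sup_right, compl_inf_self, sup_bot_eq]
            exact inf_le_right.trans inf_le_left
          · exact le_trans (inf_le_inf_right _ inf_le_left) (hqw i' a' v' hv' hmem)
        · intro t ht hts hmaxt htb
          rw [Finset.mem_insert, not_or] at hts
          have h1 : A.c (ρ t) q = q :=
            hqc t ht hts.2 (fun w' hw' => hmaxt w' (Finset.mem_insert_of_mem hw')) htb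
          have h2 : A.c (ρ t) z = z := by
            refine c_subst_coordMap hA hρ hinj hcl (fun j => ?_) ht (fun j he => ?_) a
            · by_cases hj : j = i
              · subst hj
                simpa using hwT
              · simpa [hj] using hv j
            · by_cases hj : j = i
              · subst hj
                simp only [Function.update_self] at he
                exact hts.1 he.symm
              · simp only [Function.update_of_ne hj] at he
                have h3 : (v j).depth < w.depth := depth_lt i.1 a v j
                rw [he] at h3
                exact absurd (hmaxt w (Finset.mem_insert_self _ _)) (not_le.2 h3)
          have h3 : A.c (ρ t) (A.c (ρ w) z)ᶜ = (A.c (ρ w) z)ᶜ := by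
            refine hA.c_compl_of_closed ?_
            rw [hA.c_comm, h2]
          refine hA.inf_closed h1 ?_
          rw [hA.c_sup, h2, h3]
      · refine ⟨q, hq0, hqx, fun i a v hv hmem => ?_, fun t ht hts hmaxt htb => ?_⟩
        · rcases Finset.mem_insert.1 hmem with heq | hmem
          · exact absurd ⟨i, a, v, hv, heq.symm⟩ hw
          · exact hqw i a v hv hmem
        · exact hqc t ht (fun h' => hts (Finset.mem_insert_of_mem h'))
            (fun w' hw' => hmaxt w' (Finset.mem_insert_of_mem hw')) htb
  obtain ⟨q, hq0, hqx, hqw, -⟩ := main T subset_rfl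
  exact ⟨q, hq0, hqx, hqw⟩

theorem exists_isHenkin_finset (hA : A ∈ Edc ι) {x : A} (hx : x ≠ ⊥)
    (T : Finset (HenkinTerm Γ A.carrier)) (hbase : ∀ i ∈ Γ, base i ∈ T) :
    ∃ F E, IsHenkin A Γ x T F E := by
  obtain ⟨K, hK, hdisj, h, hh, hne, hcl⟩ := exists_reductEndo_of_mem_Edc hA Γ hx (T.card + 1)
  obtain ⟨hA, -⟩ := hA
  obtain ⟨ρ, hρK, hinj⟩ : ∃ ρ : HenkinTerm Γ A.carrier → ι, (∀ t, ρ t ∈ K) ∧ Set.InjOn ρ T := by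
    have : Nonempty K := Finset.Nonempty.to_subtype (Finset.card_pos.1 (by omega))
    obtain ⟨e⟩ : Nonempty (T ↪ K) := Function.Embedding.nonempty_of_card_le (by simp [hK])
    classical
    refine ⟨fun t => if ht : t ∈ T then (e ⟨t, ht⟩).1 else (Classical.arbitrary K).1,
      fun t => ?_, fun s hs t ht hst => ?_⟩
    · dsimp only
      split_ifs
      exacts [(e _).2, (Classical.arbitrary K).2]
    · have hs' : s ∈ T := hs
      have ht' : t ∈ T := ht
      simp only [hs', ht', dif_pos] at hst
      simpa using e.injective (Subtype.ext hst)
  have hρ : ∀ t ∈ T, ρ t ∉ Γ := fun t _ hm => Finset.disjoint_left.1 hdisj hm (hρK t)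
  have hcl' : ∀ t ∈ T, ∀ a, A.c (ρ t) (h a) = h a := fun t _ => hcl _ (hρK t)
  obtain ⟨q, hq0, hqx, hqw⟩ := exists_ne_bot_le_witness hA hρ hinj hcl' hbase hne
  obtain ⟨u, huq, husup, hucompl, humono⟩ := exists_ultrafilter_of_ne_bot hq0
  have huinf : ∀ y z, u y → u z → u (y ⊓ z) := by
    intro y z hy hz
    by_contra hcon
    rw [← hucompl, compl_inf, husup, hucompl, hucompl] at hcon
    tauto
  have hnot : ∀ v : Γ → HenkinTerm Γ A.carrier, (∀ j, v j ∈ T) → ∀ j ∈ Γ, coordMap ρ v j ∉ Γ :=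
    fun v hv => coordMap_notMem hρ hv
  refine ⟨fun a v => u (A.subst (coordMap ρ v) Γ.toList (h a)), fun s t => u (A.d (ρ s) (ρ t)),
    ⟨?_, ?_, ?_, ?_, ?_, ?_, ?_, ?_, ?_, ?_, ?_⟩⟩
  · intro v hv a b
    rw [hh.map_sup, hA.subst_sup, husup]
  · intro v hv a
    rw [hh.map_compl, hA.subst_compl (by simpa using hnot v hv), hucompl]
  · intro v hv i a t ht hF
    rw [hh.map_c i i.2] at hF ⊢
    rwa [coordMap_update, hA.subst_update_c i.2 (hnot v hv) (hρ t ht)]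
  · intro v hv i a hF
    rw [hh.map_c i i.2]
    exact humono _ _ (hA.subst_mono _ _ (hA.le_c i _)) hF
  · intro v hv i a hw hF
    have hfresh : ∀ j ∈ Γ, ρ (wit i.1 a v) ≠ coordMap ρ v j := by
      intro j hj he
      rw [coordMap_apply ρ v ⟨j, hj⟩] at he
      have := depth_lt i.1 a v ⟨j, hj⟩
      rw [hinj hw (hv _) he] at this
      exact lt_irrefl _ this
    rw [hh.map_c i i.2, ← hA.c_subst_update i.2 (hnot v hv) (hρ _ hw) hfresh (hcl' _ hw a),
      ← coordMap_update] at hF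
    exact humono _ _ (hqw i a v hv hw) (huinf _ _ huq hF)
  · intro v hv i j
    rw [hh.map_d i i.2 j j.2, hA.subst_d Γ.nodup_toList (by simpa using hnot v hv)]
    simp [coordMap_apply]
  · intro t _
    rw [hA.d_self]
    exact humono _ _ le_top huq
  · intro s _ t _ hst
    rwa [hA.d_symm]
  · intro r _ s _ t _ hrs hst
    exact humono _ _ (hA.d_inf_d_le _ _ _) (huinf _ _ hrs hst)
  · intro v hv i a t ht hE hF
    rw [coordMap_update]
    refine humono _ _ (hA.d_inf_subst_le i.2 (hnot v hv) (hρ t ht) (h a)) (huinf _ _ ?_ hF)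
    rwa [coordMap_apply]
  · exact humono _ _ hqx huq

/-- The limit of the finite stages along an ultrafilter. -/
theorem exists_isHenkin_univ (hA : A ∈ Edc ι) {x : A} (hx : x ≠ ⊥) :
    ∃ F E, IsHenkin A Γ x Set.univ F E := by
  classical
  have hfin : ∀ T : Finset (HenkinTerm Γ A.carrier), ∃ F E, (∀ i ∈ Γ, base i ∈ T) →
      IsHenkin A Γ x T F E := by
    intro T
    by_cases hT : ∀ i ∈ Γ, base i ∈ T
    · obtain ⟨F, E, h⟩ := exists_isHenkin_finset hA hx T hT
      exact ⟨F, E, fun _ => h⟩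
    · exact ⟨fun _ _ => True, fun _ _ => True, fun h => absurd h hT⟩
  choose F E hFE using hfin
  let D : Ultrafilter (Finset (HenkinTerm Γ A.carrier)) := Ultrafilter.of Filter.atTop
  have hle : (D : Filter (Finset (HenkinTerm Γ A.carrier))) ≤ Filter.atTop :=
    Ultrafilter.of_le Filter.atTop
  have hmem : ∀ t : HenkinTerm Γ A.carrier, ∀ᶠ T in (D : Filter (Finset _)), t ∈ T := fun t =>
    hle ((Filter.eventually_ge_atTop {t}).mono fun T hT => hT (Finset.mem_singleton_self t))
  have hv : ∀ v : Γ → HenkinTerm Γ A.carrier, ∀ᶠ T in (D : Filter (Finset _)), ∀ j, v j ∈ T := fun v =>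
    Filter.eventually_all.2 fun j => hmem _
  have hgood : ∀ᶠ T : Finset (HenkinTerm Γ A.carrier) in D,
      IsHenkin A Γ x T (F T) (E T) := by
    filter_upwards [hv fun i => base i.1] with T hT
    exact hFE T fun i hi => hT ⟨i, hi⟩
  refine ⟨fun a v => ∀ᶠ T in (D : Filter (Finset _)), F T a v, fun s t => ∀ᶠ T in (D : Filter (Finset _)), E T s t,
    ⟨?_, ?_, ?_, ?_, ?_, ?_, ?_, ?_, ?_, ?_, ?_⟩⟩
  · intro v _ a b
    rw [← Ultrafilter.eventually_or]
    refine Filter.eventually_congr ?_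
    filter_upwards [hgood, hv v] with T hT hvT using hT.sup v hvT a b
  · intro v _ a
    rw [← Ultrafilter.eventually_not]
    refine Filter.eventually_congr ?_
    filter_upwards [hgood, hv v] with T hT hvT using hT.compl v hvT a
  · intro v _ i a t _ h
    filter_upwards [hgood, hv v, hmem t, h] with T hT hvT ht h
    exact hT.c_update v hvT i a t ht h
  · intro v _ i a h
    filter_upwards [hgood, hv v, h] with T hT hvT h using hT.le_c v hvT i a h
  · intro v _ i a _ h
    filter_upwards [hgood, hv v, hmem (wit i.1 a v), h] with T hT hvT ht h
    exact hT.witness v hvT i a ht h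
  · intro v _ i j
    refine Filter.eventually_congr ?_
    filter_upwards [hgood, hv v] with T hT hvT using hT.d v hvT i j
  · intro t _
    filter_upwards [hgood, hmem t] with T hT ht using hT.refl t ht
  · intro s _ t _ h
    filter_upwards [hgood, hmem s, hmem t, h] with T hT hs ht h using hT.symm s hs t ht h
  · intro r _ s _ t _ h h'
    filter_upwards [hgood, hmem r, hmem s, hmem t, h, h'] with T hT hr hs ht h h'
    exact hT.trans r hr s hs t ht h h'
  · intro v _ i a t _ h h'
    filter_upwards [hgood, hv v, hmem t, h, h'] with T hT hvT ht h h'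
    exact hT.congr v hvT i a t ht h h'
  · filter_upwards [hgood] with T hT using hT.base

end FiniteStage

/-! ### Representations of finite reducts, and their ultraproduct -/

/-- `g` represents the `Γ`-reduct of `A` by sets of `ι`-sequences over `U`. -/
structure IsReductRep {ι : Type u} [DecidableEq ι] (A : CylAlg.{u, v} ι) (Γ : Set ι) {U : Type w}
    (g : A → Set (ι → U)) : Prop where
  sup : ∀ (a b : A) s, s ∈ g (a ⊔ b) ↔ s ∈ g a ∨ s ∈ g b
  compl : ∀ (a : A) s, s ∈ g aᶜ ↔ s ∉ g a
  c : ∀ i ∈ Γ, ∀ (a : A) s, s ∈ g (A.c i a) ↔ ∃ u, Function.update s i u ∈ g a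
  d : ∀ i ∈ Γ, ∀ j ∈ Γ, ∀ s, s ∈ g (A.d i j) ↔ s i = s j

/-- Identifying equal Henkin terms gives the base of a representation. -/
theorem IsHenkin.exists_reductRep {ι : Type u} [DecidableEq ι] {A : CylAlg.{u, w} ι}
    {Γ : Finset ι} {x : A} {F : A → (Γ → HenkinTerm Γ A.carrier) → Prop}
    {E : HenkinTerm Γ A.carrier → HenkinTerm Γ A.carrier → Prop}
    (h : IsHenkin A Γ x Set.univ F E) :
    ∃ (U : Type (max u w)) (g : A → Set (ι → U)), IsReductRep A Γ g ∧ (g x).Nonempty := by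
  have hu : ∀ v : Γ → HenkinTerm Γ A.carrier, ∀ j, v j ∈ (Set.univ : Set _) :=
    fun _ _ => trivial
  let S : Setoid (HenkinTerm Γ A.carrier) :=
    { r := E
      iseqv := ⟨fun t => h.refl t trivial, fun {s t} => h.symm s trivial t trivial,
        fun {r s t} => h.trans r trivial s trivial t trivial⟩ }
  have hcongr : ∀ (a : A) (v v' : Γ → HenkinTerm Γ A.carrier), (∀ i, E (v i) (v' i)) → F a v →
      F a v' := by
    intro a v v' hE hF
    -- The entries of `v` are replaced one after the other.
    have key : ∀ Δ : Finset Γ, F a fun i => if i ∈ Δ then v' i else v i := by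
      intro Δ
      induction Δ using Finset.induction_on with
      | empty => simpa using hF
      | insert i Δ hi ih =>
        have h1 := h.congr _ (hu _) i a (v' i) trivial (by simpa [hi] using hE i) ih
        convert h1 using 1
        ext1 j
        by_cases hj : j = i
        · subst hj
          simp
        · simp [hj]
    simpa using key Finset.univ
  let rep : (ι → Quotient S) → Γ → HenkinTerm Γ A.carrier := fun s i => (s i).out
  have hout : ∀ t, E (Quotient.mk S t).out t := fun t =>
    (Quotient.exact (Quotient.out_eq (Quotient.mk S t)) : S _ _)
  refine ⟨Quotient S, fun a => {s | F a (rep s)}, ⟨?_, ?_, ?_, ?_⟩, ?_⟩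
  · exact fun a b s => h.sup _ (hu _) a b
  · exact fun a s => h.compl _ (hu _) a
  · intro i hi a s
    constructor
    · intro hF
      refine ⟨Quotient.mk S (HenkinTerm.wit i a (rep s)), ?_⟩
      refine hcongr a _ _ (fun j => ?_) (h.witness (rep s) (hu _) ⟨i, hi⟩ a trivial hF)
      by_cases hj : j = ⟨i, hi⟩
      · subst hj
        simpa [rep] using h.symm _ trivial _ trivial (hout _)
      · have hj' : (j : ι) ≠ i := fun he => hj (Subtype.ext he)
        simpa [rep, hj, hj'] using h.refl _ trivial
    · rintro ⟨u, hF⟩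
      have h1 := h.c_update _ (hu _) ⟨i, hi⟩ a (s i).out trivial
        (h.le_c _ (hu _) ⟨i, hi⟩ a hF)
      change F (A.c i a) (rep s)
      convert h1 using 1
      ext1 j
      by_cases hj : j = ⟨i, hi⟩
      · subst hj
        simp [rep]
      · have hj' : (j : ι) ≠ i := fun he => hj (Subtype.ext he)
        simp [rep, hj, hj']
  · intro i hi j hj s
    refine (h.d (rep s) (hu _) ⟨i, hi⟩ ⟨j, hj⟩).trans ?_
    exact ⟨fun hE => Quotient.out_equiv_out.1 hE, fun he => Quotient.out_equiv_out.2 he⟩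
  · refine ⟨fun i => Quotient.mk S (HenkinTerm.base i), ?_⟩
    exact hcongr x _ _ (fun i => h.symm _ trivial _ trivial (hout _)) h.base

/-- Representations of all finite reducts are glued by an ultraproduct of their bases. As a
sequence of classes has infinitely many entries, it is lifted to the factors by a choice of
representatives; that choice depends on the coordinate, so that a given sequence of
factor-wise members of `g x` can be the lift of a sequence in the ultraproduct. -/
theorem exists_rep_of_finite_reductRep {ι : Type u} [DecidableEq ι] {A : CylAlg.{u, v} ι} {x : A}
    (H : ∀ Γ : Finset ι, ∃ (U : Type (max u w)) (g : A → Set (ι → U)),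
      IsReductRep A Γ g ∧ (g x).Nonempty) :
    ∃ (U : Type (max u w)) (g : A → Set (ι → U)), IsReductRep A Set.univ g ∧ (g x).Nonempty := by
  choose U g hg p hp using H
  let D : Ultrafilter (Finset ι) := Ultrafilter.of Filter.atTop
  have hle : (D : Filter (Finset ι)) ≤ Filter.atTop := Ultrafilter.of_le Filter.atTop
  have hmem : ∀ i : ι, ∀ᶠ Γ : Finset ι in D, i ∈ Γ := fun i =>
    hle ((Filter.eventually_ge_atTop {i}).mono fun Γ hΓ => hΓ (Finset.mem_singleton_self i))
  let S : Setoid (∀ Γ, U Γ) := (D : Filter (Finset ι)).productSetoid U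
  have hS : ∀ a b, Quotient.mk S a = Quotient.mk S b ↔ ∀ᶠ Γ : Finset ι in D, a Γ = b Γ :=
    fun a b => ⟨fun h => Quotient.exact h, fun h => Quotient.sound h⟩
  classical
  let lift : ι → Quotient S → ∀ Γ, U Γ := fun i q =>
    if q = Quotient.mk S (fun Γ => p Γ i) then fun Γ => p Γ i else q.out
  have hlift : ∀ i q, Quotient.mk S (lift i q) = q := by
    intro i q
    by_cases hq : q = Quotient.mk S (fun Γ => p Γ i)
    · simp only [lift, if_pos hq]
      exact hq.symm
    · simp only [lift, if_neg hq, Quotient.out_eq]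
  let proj : (ι → Quotient S) → ∀ Γ, ι → U Γ := fun s Γ i => lift i (s i) Γ
  have hproj : ∀ s i (q : Quotient S) Γ,
      proj (Function.update s i q) Γ = Function.update (proj s Γ) i (lift i q Γ) := by
    intro s i q Γ
    ext1 j
    by_cases hj : j = i
    · subst hj
      simp [proj]
    · simp [proj, hj]
  refine ⟨Quotient S, fun a => {s | ∀ᶠ Γ : Finset ι in D, proj s Γ ∈ g Γ a}, ⟨?_, ?_, ?_, ?_⟩, ?_⟩
  · intro a b s
    refine Iff.trans ?_ Ultrafilter.eventually_or
    exact Filter.eventually_congr (Filter.Eventually.of_forall fun Γ => (hg Γ).sup a b _)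
  · intro a s
    refine Iff.trans ?_ Ultrafilter.eventually_not
    exact Filter.eventually_congr (Filter.Eventually.of_forall fun Γ => (hg Γ).compl a _)
  · intro i _ a s
    constructor
    · intro hs
      have hex : ∀ Γ, ∃ u : U Γ, proj s Γ ∈ g Γ (A.c i a) → i ∈ Γ →
          Function.update (proj s Γ) i u ∈ g Γ a := by
        intro Γ
        by_cases hc : proj s Γ ∈ g Γ (A.c i a) ∧ i ∈ Γ
        · obtain ⟨u, hu⟩ := ((hg Γ).c i hc.2 a _).1 hc.1
          exact ⟨u, fun _ _ => hu⟩
        · exact ⟨p Γ i, fun h1 h2 => absurd ⟨h1, h2⟩ hc⟩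
      choose u hu using hex
      refine ⟨Quotient.mk S u, ?_⟩
      filter_upwards [hs, hmem i, (hS _ _).1 (hlift i (Quotient.mk S u))] with Γ h1 h2 h3
      rw [hproj, h3]
      exact hu Γ h1 h2
    · rintro ⟨q, hq⟩
      filter_upwards [hq, hmem i] with Γ h1 h2
      rw [hproj] at h1
      exact ((hg Γ).c i h2 a _).2 ⟨_, h1⟩
  · intro i _ j _ s
    have h1 : s i = s j ↔ ∀ᶠ Γ : Finset ι in D, proj s Γ i = proj s Γ j := by
      rw [← hS (lift i (s i)) (lift j (s j)), hlift, hlift]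
    rw [h1]
    refine Filter.eventually_congr ?_
    filter_upwards [hmem i, hmem j] with Γ hi hj using (hg Γ).d i hi j hj _
  · refine ⟨fun i => Quotient.mk S fun Γ => p Γ i, Filter.Eventually.of_forall fun Γ => ?_⟩
    have : proj (fun i => Quotient.mk S fun Γ => p Γ i) Γ = p Γ := by
      ext1 i
      simp [proj, lift]
    rw [this]
    exact hp Γ

/-- An algebra whose nonzero elements are separated by representations is embedded into the set
algebra on the disjoint union of the spaces involved. -/
theorem mem_RCA_of_reductRep {ι : Type u} [DecidableEq ι] [Nontrivial ι] {A : CylAlg.{u, v} ι}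
    (H : ∀ x : A, x ≠ ⊥ → ∃ (U : Type (max u v)) (g : A → Set (ι → U)),
      IsReductRep A Set.univ g ∧ (g x).Nonempty) : A ∈ RCA ι := by
  choose! U g hg hne using H
  let X := {x : A // x ≠ ⊥}
  let B := Σ x : X, U x.1
  let W : X → Set B := fun x => Set.range (Sigma.mk x)
  let V : Set (ι → B) := ⋃ w ∈ Set.range W, space ι w
  obtain ⟨i₀⟩ : Nonempty ι := inferInstance
  have hV : ∀ s : V, ∃ (x : X) (t : ι → U x.1), ∀ i, s.1 i = ⟨x, t i⟩ := by
    rintro ⟨s, hs⟩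
    simp only [V, Set.mem_iUnion, exists_prop, Set.mem_range] at hs
    obtain ⟨_, ⟨x, rfl⟩, hs⟩ := hs
    choose t ht using hs
    exact ⟨x, t, fun i => (ht i).symm⟩
  have hmk : ∀ (x : X) (t : ι → U x.1), (fun i => (⟨x, t i⟩ : B)) ∈ V := by
    intro x t
    simp only [V, Set.mem_iUnion, exists_prop, Set.mem_range]
    exact ⟨_, ⟨x, rfl⟩, fun i => ⟨t i, rfl⟩⟩
  have huniq : ∀ (a : A) (x y : X) (t : ι → U x.1) (r : ι → U y.1),
      (∀ i, (⟨x, t i⟩ : B) = ⟨y, r i⟩) → t ∈ g x.1 a → r ∈ g y.1 a := by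
    intro a x y t r htr ht
    obtain ⟨rfl, -⟩ := Sigma.mk.inj_iff.1 (htr i₀)
    have : t = r := funext fun i => eq_of_heq (Sigma.mk.inj_iff.1 (htr i)).2
    exact this ▸ ht
  let f : A → Set V := fun a =>
    {s | ∃ (x : X) (t : ι → U x.1), (∀ i, s.1 i = ⟨x, t i⟩) ∧ t ∈ g x.1 a}
  have hf : ∀ (a : A) (s : V) (x : X) (t : ι → U x.1), (∀ i, s.1 i = ⟨x, t i⟩) →
      (s ∈ f a ↔ t ∈ g x.1 a) := by
    intro a s x t hst
    refine ⟨?_, fun ht => ⟨x, t, hst, ht⟩⟩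
    rintro ⟨y, r, hsr, hr⟩
    exact huniq a y x r t (fun i => (hsr i).symm.trans (hst i)) hr
  refine ⟨B, V, ⟨Set.range W, ?_, rfl⟩, ⟨f, ?_, ?_, ?_, ?_⟩, ?_⟩
  · rintro _ ⟨x, rfl⟩ _ ⟨y, rfl⟩ hne
    rw [Function.onFun, Set.disjoint_left]
    intro s hs hs'
    obtain ⟨a, ha⟩ := hs i₀
    obtain ⟨b, hb⟩ := hs' i₀
    obtain ⟨rfl, -⟩ := Sigma.mk.inj_iff.1 (ha.trans hb.symm)
    exact hne rfl
  · intro a b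
    ext s
    obtain ⟨x, t, hst⟩ := hV s
    refine (hf _ s x t hst).trans (((hg _ x.2).sup a b t).trans ?_)
    exact (or_congr (hf a s x t hst) (hf b s x t hst)).symm
  · intro a
    ext s
    obtain ⟨x, t, hst⟩ := hV s
    refine (hf _ s x t hst).trans (((hg _ x.2).compl a t).trans ?_)
    exact (not_congr (hf a s x t hst)).symm
  · intro i a
    ext s
    obtain ⟨x, t, hst⟩ := hV s
    refine (hf _ s x t hst).trans (((hg _ x.2).c i trivial a t).trans ⟨?_, ?_⟩)
    · rintro ⟨u, hu⟩
      refine ⟨⟨_, hmk x (Function.update t i u)⟩, (hf a _ x _ fun _ => rfl).2 hu, fun j hj => ?_⟩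
      simp [hst j, hj]
    · rintro ⟨s', ⟨y, r, hs'r, hr⟩, hss'⟩
      obtain ⟨j, hj⟩ := exists_ne i
      obtain ⟨rfl, -⟩ := Sigma.mk.inj_iff.1 ((hst j).symm.trans ((hss' j hj).trans (hs'r j)))
      refine ⟨r i, ?_⟩
      convert hr using 1
      ext1 k
      by_cases hk : k = i
      · subst hk
        simp
      · rw [Function.update_of_ne hk]
        have hk' := (hst k).symm.trans ((hss' k hk).trans (hs'r k))
        exact eq_of_heq (Sigma.mk.inj_iff.1 hk').2
  · intro i j
    ext s
    obtain ⟨x, t, hst⟩ := hV s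
    refine (hf _ s x t hst).trans (((hg _ x.2).d i trivial j trivial t).trans ?_)
    change _ ↔ s.1 i = s.1 j
    rw [hst i, hst j]
    exact ⟨fun h => by rw [h], fun h => eq_of_heq (Sigma.mk.inj_iff.1 h).2⟩
  · have hle : ∀ a b : A, f a = f b → a ≤ b := by
      intro a b hab
      by_contra hcon
      have hx : (aᶜ ⊔ b)ᶜ ≠ ⊥ := by
        rw [compl_sup, compl_compl, ← sdiff_eq]
        exact fun h => hcon (sdiff_eq_bot_iff.1 h)
      obtain ⟨t, ht⟩ := hne _ hx
      rw [(hg _ hx).compl, (hg _ hx).sup, (hg _ hx).compl, not_or, not_not] at ht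
      refine ht.2 ?_
      have h1 := hf a ⟨_, hmk ⟨_, hx⟩ t⟩ ⟨_, hx⟩ t fun _ => rfl
      rw [hab] at h1
      exact (hf b ⟨_, hmk ⟨_, hx⟩ t⟩ ⟨_, hx⟩ t fun _ => rfl).1 (h1.2 ht.1)
    exact fun a b hab => le_antisymm (hle a b hab) (hle b a hab.symm)

theorem mem_RCA_of_mem_Edc {ι : Type u} [Infinite ι] {A : CylAlg.{u, max u v} ι}
    (hA : A ∈ Edc ι) : A ∈ RCA ι := by
  classical
  refine mem_RCA_of_reductRep.{u, max u v} fun x hx => ?_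
  refine exists_rep_of_finite_reductRep.{u, max u v, max u v} fun Γ => ?_
  obtain ⟨F, E, h⟩ := exists_isHenkin_univ (Γ := Γ) hA hx
  exact h.exists_reductRep

/-! ### The class of representable algebras -/

theorem CylAlg.Embeds.refl {ι : Type u} (A : CylAlg.{u, w} ι) : A.Embeds A :=
  ⟨⟨id, fun _ _ => rfl, fun _ => rfl, fun _ _ => rfl, fun _ _ => rfl⟩, Function.injective_id⟩

theorem CylAlg.Embeds.trans {ι : Type u} {A B : CylAlg.{u, v} ι}
    {C : CylAlg.{u, w} ι} : A.Embeds B → B.Embeds C → A.Embeds C := by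
  rintro ⟨f, hf⟩ ⟨g, hg⟩
  refine ⟨⟨g.toFun ∘ f.toFun, fun x y => ?_, fun x => ?_, fun i x => ?_, fun i j => ?_⟩,
    hg.comp hf⟩
  · exact (congrArg g.toFun (f.map_sup x y)).trans (g.map_sup _ _)
  · exact (congrArg g.toFun (f.map_compl x)).trans (g.map_compl _)
  · exact (congrArg g.toFun (f.map_c i x)).trans (g.map_c _ _)
  · exact (congrArg g.toFun (f.map_d i j)).trans (g.map_d _ _)

theorem theorem4p3 (ι : Type u) [Infinite ι] :
    (∃ A : CylAlg.{u, max u v} ι, A ∈ RCA ι ∧ A ∉ Edc ι) ∧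
    (∀ A : CylAlg.{u, max u v} ι, A ∈ RCA ι →
      ∃ B : CylAlg.{u, max u v} ι, B ∈ Edc ι ∧ A.Embeds B) ∧
    (Edc ι : Set (CylAlg.{u, max u v} ι)) ⊂ SubClass (Edc ι) ∧
    SubClass (Edc ι) = (RCA ι : Set (CylAlg.{u, max u v} ι)) := by
  have hemb : ∀ A : CylAlg.{u, max u v} ι, A ∈ RCA ι →
      ∃ B : CylAlg.{u, max u v} ι, B ∈ Edc ι ∧ A.Embeds B := by
    rintro A ⟨U, V, hV, hAV⟩
    exact ⟨fullSetAlg V, fullSetAlg_mem_Edc.{u, max u v} hV, hAV⟩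
  have heq : SubClass (Edc ι) = (RCA ι : Set (CylAlg.{u, max u v} ι)) := by
    refine Set.Subset.antisymm ?_ hemb
    rintro A ⟨B, hB, hAB⟩
    obtain ⟨U, V, hV, hBV⟩ := mem_RCA_of_mem_Edc.{u, v} hB
    exact ⟨U, V, hV, hAB.trans hBV⟩
  obtain ⟨A, hA, hA'⟩ := exists_mem_RCA_not_mem_Edc.{u, v} ι
  refine ⟨⟨A, hA, hA'⟩, hemb, ?_, heq⟩
  have hsub : (Edc ι : Set (CylAlg.{u, max u v} ι)) ⊆ SubClass (Edc ι) :=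
    fun B hB => ⟨B, hB, .refl B⟩
  exact (Set.ssubset_iff_of_subset hsub).2 ⟨A, heq ▸ hA, hA'⟩
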